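/- Let $\mathcal X,\mathcal Y$ be finite sets, $f:\mathcal X\times\mathcal Y\to\mathcal Z$ a function, $\mu$ a probability distribution on $\mathcal X\times\mathcal Y$, and $k$ a number of rounds. In a $k$-round protocol Alice (who knows $x\in\mathcal X$) and Bob (who knows $y\in\mathcal Y$) alternately send $k$ messages, which are bit strings (possibly empty); each message depends on the sender's input, the earlier messages and, in a private-coin protocol, on the sender's own random coins, which have finite range and are independent of the inputs and of the other player's coins. A protocol is prefix-free if after every sequence of earlier messages no possible next message is a proper prefix of another one. At the end an answer in $\mathcal Z$ is determined, according to a fixed convention that is the same for all protocols: by Alice, by Bob (each from the own input, the own coins and the transcript), by the transcript alone, or by several of these, all of which then have to be right. Let $\Pi$ be a $k$-round private-coin protocol whose average error for $f$ under $\mu$, that is, the probability over $(X,Y)\sim\mu$ and the coins that the answer is not $f(X,Y)$, is at most $\delta$. Let $T$ be the complete transcript of $\Pi$ on $(X,Y)$, and suppose that its information cost satisfies $I(XY:T)=H(XY)+H(T)-H(XYT)\le a$, where $H$ is Shannon entropy in bits. Then for every $\varepsilon>0$ there is a deterministic prefix-free $k$-round protocol $\Pi'$, with the same player sending the first message, such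 that (a) on every input $(x,y)$ the total number of bits exchanged in $\Pi'$ is at most $\dfrac{2k(a+1)}{\varepsilon^2}+\dfrac{2k}{\varepsilon}$; (b) the distributional error of $\Pi'$ under $\mu$, that is, the probability over $(X,Y)\sim\mu$ that its answer is not $f(X,Y)$, is at most $\delta+2\varepsilon$. -/

import Mathlib

namespace TwoParty

/-! ### Probability and information on a finite sample space -/

open Classical in
/-- The probability of the event `E` under `p`. -/
noncomputable def prob {Ω : Type*} [Fintype Ω] (p : PMF Ω) (E : Set Ω) : ℝ :=
  ∑ ω ∈ Finset.univ.filter (fun ω => ω ∈ E), (p ω).toReal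

open Classical in
/-- Shannon entropy, in bits, of the random variable `V` on the sample space `(Ω, p)`. -/
noncomputable def entropy {Ω S : Type*} [Fintype Ω] (p : PMF Ω) (V : Ω → S) : ℝ :=
  -∑ s ∈ Finset.univ.image V, prob p {ω | V ω = s} * Real.logb 2 (prob p {ω | V ω = s})

/-- Mutual information `I(V : W) = H(V) + H(W) - H(VW)`, in bits. -/
noncomputable def mutualInfo {Ω S S' : Type*} [Fintype Ω] (p : PMF Ω)
    (V : Ω → S) (W : Ω → S') : ℝ :=
  entropy p V + entropy p W - entropy p (fun ω => (V ω, W ω))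

/-! ### Deterministic protocols -/

/-- The two players. -/
inductive Party
  | alice
  | bob

/-- The other player. -/
def Party.other : Party → Party
  | .alice => .bob
  | .bob => .alice

/-- The player who sends message number `i` (counted from `0`) when the players alternate and
`first` sends message number `0`. -/
def speaker (first : Party) (i : ℕ) : Party :=
  if Even i then first else first.other

/-- A message is a bit string. -/
abbrev Message := List Bool

/-- The list of the messages sent so far, in chronological order. -/
abbrev History := List Message

/-- Whose answer is looked at when a protocol ends: the one of Alice or of Bob, who know their own
input and the transcript, or an answer that is read off the transcript alone. -/
inductive Answerer
  | alice
  | bob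
  | transcript

/-- A deterministic two-party protocol with `k` rounds (one message per round, the players
alternate, `first` starts). A message depends on the sender's input and on the earlier messages. -/
structure Protocol (X Y Z : Type*) (k : ℕ) (first : Party) where
  /-- The message that Alice sends if it is her turn. -/
  msgAlice : X → History → Message
  /-- The message that Bob sends if it is his turn. -/
  msgBob : Y → History → Message
  /-- Alice's answer, from her input and the complete transcript. -/
  outAlice : X → History → Z
  /-- Bob's answer, from his input and the complete transcript. -/
  outBob : Y → History → Z
  /-- The answer determined by the complete transcript alone. -/
  outTranscript : History → Z

namespace Protocol

variable {X Y Z : Type*} {k : ℕ} {first : Party}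

/-- The message sent by the given player on inputs `x`, `y` after the history `h`. -/
def msg (P : Protocol X Y Z k first) (x : X) (y : Y) (h : History) : Party → Message
  | .alice => P.msgAlice x h
  | .bob => P.msgBob y h

/-- The first `i` messages on inputs `x`, `y`. -/
def history (P : Protocol X Y Z k first) (x : X) (y : Y) : ℕ → History
  | 0 => []
  | i + 1 => P.history x y i ++ [P.msg x y (P.history x y i) (speaker first i)]

/-- The complete transcript: all `k` messages. -/
def transcript (P : Protocol X Y Z k first) (x : X) (y : Y) : History :=
  P.history x y k

/-- The answers on inputs `x`, `y`. -/
def output (P : Protocol X Y Z k first) (x : X) (y : Y) : Answerer → Z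
  | .alice => P.outAlice x (P.transcript x y)
  | .bob => P.outBob y (P.transcript x y)
  | .transcript => P.outTranscript (P.transcript x y)

/-- The number of bits exchanged on inputs `x`, `y`. -/
def bits (P : Protocol X Y Z k first) (x : X) (y : Y) : ℕ :=
  ((P.transcript x y).map List.length).sum

/-- The communication cost: the maximal number of bits exchanged. -/
def cost [Fintype X] [Fintype Y] (P : Protocol X Y Z k first) : ℕ :=
  (Finset.univ : Finset (X × Y)).sup fun z => P.bits z.1 z.2

/-- After every history the possible messages form a prefix-free set, so that the receiver
recognises the end of a message and no information is hidden in message lengths. -/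
def PrefixFree (P : Protocol X Y Z k first) : Prop :=
  (∀ h x x', P.msgAlice x h <+: P.msgAlice x' h → P.msgAlice x h = P.msgAlice x' h) ∧
  (∀ h y y', P.msgBob y h <+: P.msgBob y' h → P.msgBob y h = P.msgBob y' h)

/-- The distributional error under `μ`: the probability that some answerer in `A` does not
answer `f x y`. -/
noncomputable def distError [Fintype X] [Fintype Y] (P : Protocol X Y Z k first)
    (A : Set Answerer) (f : X → Y → Z) (μ : PMF (X × Y)) : ℝ :=
  prob μ {z | ¬ ∀ o ∈ A, P.output z.1 z.2 o = f z.1 z.2}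

end Protocol

/-! ### Private coin protocols -/

/-- A private coin protocol: Alice has a random `r : R`, Bob has a random `s : S`, and then they
act deterministically, each knowing the own input and the own coins only. -/
structure PrivateCoinProtocol (X Y Z R S : Type*) (k : ℕ) (first : Party) where
  /-- The law of Alice's coins. -/
  coinAlice : PMF R
  /-- The law of Bob's coins. -/
  coinBob : PMF S
  /-- What the players do, given inputs and coins. -/
  act : Protocol (X × R) (Y × S) Z k first

namespace PrivateCoinProtocol

variable {X Y Z R S : Type*} {k : ℕ} {first : Party}

/-- The joint law of the inputs `(x, y)` and the coins `(r, s)`: the inputs have law `μ`, and the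
inputs, Alice's coins and Bob's coins are independent. -/
noncomputable def law (P : PrivateCoinProtocol X Y Z R S k first) (μ : PMF (X × Y)) :
    PMF ((X × Y) × (R × S)) :=
  μ.bind fun z => P.coinAlice.bind fun r => P.coinBob.map fun s => (z, (r, s))

/-- The transcript as a random variable. -/
def randomTranscript (P : PrivateCoinProtocol X Y Z R S k first) :
    (X × Y) × (R × S) → History :=
  fun ω => P.act.transcript (ω.1.1, ω.2.1) (ω.1.2, ω.2.2)

/-- The average error under `μ`: the probability, over inputs and coins, that some answerer in
`A` does not answer `f x y`. -/
noncomputable def avgError [Fintype X] [Fintype Y] [Fintype R] [Fintype S]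
    (P : PrivateCoinProtocol X Y Z R S k first)
    (A : Set Answerer) (f : X → Y → Z) (μ : PMF (X × Y)) : ℝ :=
  prob (P.law μ)
    {ω | ¬ ∀ o ∈ A, P.act.output (ω.1.1, ω.2.1) (ω.1.2, ω.2.2) o = f ω.1.1 ω.1.2}

/-- The information cost under `μ`: the mutual information, in bits, between the pair of inputs
and the transcript. -/
noncomputable def infoCost [Fintype X] [Fintype Y] [Fintype R] [Fintype S]
    (P : PrivateCoinProtocol X Y Z R S k first) (μ : PMF (X × Y)) : ℝ :=
  mutualInfo (P.law μ) (fun ω => ω.1) P.randomTranscript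

end PrivateCoinProtocol

end TwoParty

/-!
The messages are simulated one after the other. Given a prediction of the next message, the sender,
who knows its true law, looks for it by greedy rejection sampling in a list of independent samples
of the prediction that both players know, and sends the index of the accepted sample in a
self-delimiting code. The expected logarithm of this index exceeds the Kullback-Leibler divergence
of the true law from the prediction by at most a constant.

The prediction of a message is its law given the earlier messages alone, so by the chain rule the
divergences add up to `I(XY : T)`, and `2 I(XY : T) + 10 k` bits suffice on average. Averaging the
combination `failure + lam * bits` makes it possible to fix all randomness: the list of samples
entry by entry, the choices of the senders, and the remaining private coins. Cutting the
deterministic protocol off at the budget costs an error that Markov's inequality bounds.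
-/

namespace TwoParty

/-! ### A self-delimiting code for the natural numbers -/

/-- The self-delimiting form of a bit string: every bit is preceded by the flag `true`, and the
word ends with the flag `false`. -/
def selfDelimit : List Bool → Message
  | [] => [false]
  | b :: l => true :: b :: selfDelimit l

theorem selfDelimit_length (l : List Bool) : (selfDelimit l).length = 2 * l.length + 1 := by
  induction l with
  | nil => rfl
  | cons b l ih => simp only [selfDelimit, List.length_cons, ih]; ring

theorem eq_of_selfDelimit_prefix {l l' : List Bool} (h : selfDelimit l <+: selfDelimit l') :
    l = l' := by
  induction l generalizing l' with
  | nil => cases l' <;> simp_all [selfDelimit]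
  | cons b l ih =>
    cases l' with
    | nil => simp [selfDelimit] at h
    | cons b' l' =>
      simp only [selfDelimit, List.cons_prefix_cons, true_and] at h
      rw [h.1, ih h.2]

/-- The prefix-free codeword that stands for the number `n`, by its self-delimited binary digits. -/
def codeword (n : ℕ) : Message := selfDelimit n.bits

theorem eq_of_codeword_prefix {n n' : ℕ} (h : codeword n <+: codeword n') : n = n' := by
  apply Nat.digits.injective 2
  rw [Nat.digits_two_eq_bits, Nat.digits_two_eq_bits, eq_of_selfDelimit_prefix h]

theorem codeword_injective : Function.Injective codeword := fun _ _ h =>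
  eq_of_codeword_prefix (h ▸ List.prefix_rfl)

theorem codeword_length_le (n : ℕ) :
    ((codeword n).length : ℝ) ≤ 2 * Real.logb 2 (n + 1) + 3 := by
  have hbits : n.bits.length ≤ Nat.log 2 (n + 1) + 1 := by
    rw [Nat.size_eq_bits_len, Nat.size_le]
    exact (Nat.lt_succ_self n).trans (Nat.lt_pow_succ_log_self one_lt_two (n + 1))
  have hlog : (Nat.log 2 (n + 1) : ℝ) ≤ Real.logb 2 (n + 1) := by
    exact_mod_cast Real.natLog_le_logb (n + 1) 2
  have hlen : ((codeword n).length : ℝ) ≤ 2 * (Nat.log 2 (n + 1) + 1) + 1 := by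
    rw [codeword, selfDelimit_length]
    exact_mod_cast (by omega : 2 * n.bits.length + 1 ≤ 2 * (Nat.log 2 (n + 1) + 1) + 1)
  linarith

theorem exists_codeword_length_le_mul (K : ℕ) {r : ℝ} (hr : 0 < r) :
    ∃ J : ℕ, ∀ n < J + K, ((codeword n).length : ℝ) ≤ r * J := by
  have hlog2 : 0 < Real.log 2 := Real.log_pos one_lt_two
  have hlog : ∀ᶠ J : ℕ in Filter.atTop, ‖Real.log J‖ ≤ r * Real.log 2 / 8 * ‖(J : ℝ)‖ :=
    (Real.isLittleO_log_id_atTop.bound (by positivity)).natCast_atTop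
  obtain ⟨J, hJ, hrJ, hKJ⟩ := (((Filter.tendsto_add_atTop_nat K).eventually hlog).and
    ((tendsto_natCast_atTop_atTop.eventually_ge_atTop (6 / r)).and
      (Filter.eventually_ge_atTop K))).exists
  refine ⟨J, fun n hn => ?_⟩
  rw [div_le_iff₀ hr] at hrJ
  have hlogJ : Real.log (J + K : ℕ) ≤ r * Real.log 2 / 8 * (2 * J) := by
    refine (Real.le_norm_self _).trans (hJ.trans ?_)
    rw [Real.norm_natCast]
    gcongr
    exact_mod_cast (by omega : J + K ≤ 2 * J)
  have hlogb : Real.logb 2 (n + 1) ≤ r * J / 4 := by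
    rw [Real.logb, div_le_iff₀ hlog2]
    have : Real.log (n + 1) ≤ Real.log (J + K : ℕ) :=
      Real.log_le_log (by positivity) (by exact_mod_cast hn)
    linarith
  linarith [codeword_length_le n]

/-! ### Greedy rejection sampling -/

section Greedy

variable {M : Type*} [Fintype M] (q p : M → ℝ)

/-- Greedy rejection sampling produces a sample of `p` from independent samples of `q` by accepting
every sample as often as `p` permits. `residual q p n m` is the part of `p m` that is still to be
produced after `n` samples. -/
noncomputable def residual : ℕ → M → ℝ
  | 0 => p
  | n + 1 => fun m => max 0 (residual n m - (∑ m', residual n m') * q m)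

/-- The probability that greedy rejection sampling accepts none of the first `n` samples. -/
noncomputable def residualMass (n : ℕ) : ℝ := ∑ m, residual q p n m

/-- The probability that greedy rejection sampling accepts sample number `n` and that this sample
is `m`. -/
noncomputable def accepted (n : ℕ) (m : M) : ℝ := residual q p n m - residual q p (n + 1) m

/-- The probability with which greedy rejection sampling accepts `m` as sample number `n`, if all
earlier samples were rejected. -/
noncomputable def acceptProb (n : ℕ) (m : M) : ℝ := accepted q p n m / (residualMass q p n * q m)

variable {q p}

theorem residual_succ (n : ℕ) (m : M) :
    residual q p (n + 1) m = max 0 (residual q p n m - residualMass q p n * q m) := rfl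

theorem accepted_le (n : ℕ) (m : M) : accepted q p n m ≤ residualMass q p n * q m := by
  rw [accepted, residual_succ]
  linarith [le_max_right 0 (residual q p n m - residualMass q p n * q m)]

theorem sum_accepted (n : ℕ) :
    ∑ m, accepted q p n m = residualMass q p n - residualMass q p (n + 1) :=
  Finset.sum_sub_distrib _ _

theorem residual_nonneg (hp : ∀ m, 0 ≤ p m) (n : ℕ) (m : M) : 0 ≤ residual q p n m := by
  cases n with
  | zero => exact hp m
  | succ n => exact le_max_left _ _

theorem residualMass_nonneg (hp : ∀ m, 0 ≤ p m) (n : ℕ) : 0 ≤ residualMass q p n :=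
  Finset.sum_nonneg fun m _ => residual_nonneg hp n m

theorem residualMass_pos (hp : ∀ m, 0 ≤ p m) {n : ℕ} {m : M} (h : 0 < residual q p n m) :
    0 < residualMass q p n :=
  Finset.sum_pos' (fun m _ => residual_nonneg hp n m) ⟨m, Finset.mem_univ m, h⟩

theorem residual_pos_of_accepted_pos (hp : ∀ m, 0 ≤ p m) {n : ℕ} {m : M}
    (h : 0 < accepted q p n m) : 0 < residual q p n m :=
  h.trans_le (sub_le_self _ (residual_nonneg hp (n + 1) m))

variable (hq : ∀ m, 0 ≤ q m) (hp : ∀ m, 0 ≤ p m)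
include hq hp

theorem residual_succ_le (n : ℕ) (m : M) : residual q p (n + 1) m ≤ residual q p n m := by
  rw [residual_succ]
  exact max_le (residual_nonneg hp n m)
    (sub_le_self _ (mul_nonneg (residualMass_nonneg hp n) (hq m)))

theorem accepted_nonneg (n : ℕ) (m : M) : 0 ≤ accepted q p n m :=
  sub_nonneg.2 (residual_succ_le hq hp n m)

theorem residual_le (n : ℕ) (m : M) : residual q p n m ≤ p m := by
  induction n with
  | zero => exact le_rfl
  | succ n ih => exact (residual_succ_le hq hp n m).trans ih

theorem residualMass_succ_le (n : ℕ) : residualMass q p (n + 1) ≤ residualMass q p n :=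
  Finset.sum_le_sum fun m _ => residual_succ_le hq hp n m

theorem residualMass_le_one (hp1 : ∑ m, p m = 1) (n : ℕ) : residualMass q p n ≤ 1 :=
  hp1 ▸ Finset.sum_le_sum fun m _ => residual_le hq hp n m

-- As long as `m` is not exhausted, all earlier samples equal to `m` were accepted.
theorem mul_residualMass_mul_add_residual_le {n : ℕ} {m : M} (h : 0 < residual q p n m) :
    n * residualMass q p n * q m + residual q p n m ≤ p m := by
  induction n with
  | zero => simp [residual]
  | succ n ih =>
    have ih := ih (h.trans_le (residual_succ_le hq hp n m))
    have hres : residual q p (n + 1) m = residual q p n m - residualMass q p n * q m := by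
      rw [residual_succ] at h ⊢
      exact max_eq_right ((lt_max_iff.1 h).resolve_left (lt_irrefl 0)).le
    have hmass : (n + 1) * (residualMass q p (n + 1) * q m)
        ≤ (n + 1) * (residualMass q p n * q m) :=
      mul_le_mul_of_nonneg_left
        (mul_le_mul_of_nonneg_right (residualMass_succ_le hq hp n) (hq m)) (by positivity)
    rw [hres]
    push_cast
    linarith

theorem residualMass_mul_acceptProb (n : ℕ) (m : M) :
    residualMass q p n * q m * acceptProb q p n m = accepted q p n m :=
  mul_div_cancel_of_imp' fun h => le_antisymm (h ▸ accepted_le n m) (accepted_nonneg hq hp n m)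

theorem acceptProb_nonneg (n : ℕ) (m : M) : 0 ≤ acceptProb q p n m :=
  div_nonneg (accepted_nonneg hq hp n m) (mul_nonneg (residualMass_nonneg hp n) (hq m))

theorem acceptProb_le_one (n : ℕ) (m : M) : acceptProb q p n m ≤ 1 :=
  div_le_one_of_le₀ (accepted_le n m) (mul_nonneg (residualMass_nonneg hp n) (hq m))

theorem pos_of_acceptProb_pos {n : ℕ} {m : M} (h : 0 < acceptProb q p n m) : 0 < p m := by
  have hacc : 0 < accepted q p n m :=
    (accepted_nonneg hq hp n m).lt_of_ne' fun h0 => by simp [acceptProb, h0] at h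
  exact (residual_pos_of_accepted_pos hp hacc).trans_le (residual_le hq hp n m)

end Greedy

/-! ### Fixing the samples in advance -/

section Codebook

variable {I M : Type*}

/-- The expected cost of a reader who goes through a list of samples, accepts sample number `j`
with probability `acc j m` if it is `m`, and then pays `c j m`; if nothing is accepted, the cost is
`e`. The samples are numbered from the last argument on. -/
def codebookCost (acc c : ℕ → M → ℝ) (e : ℝ) : List M → ℕ → ℝ
  | [], _ => e
  | m :: L, j => acc j m * c j m + (1 - acc j m) * codebookCost acc c e L (j + 1)

/-- The average of `codebookCost` over lists of independent samples from `q`. The arguments after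
the parameters are the number of samples and the number of the first sample. -/
def samplingCost [Fintype M] (q : M → ℝ) (acc c : ℕ → M → ℝ) (e : ℝ) : ℕ → ℕ → ℝ
  | 0, _ => e
  | N + 1, j =>
    ∑ m, q m * (acc j m * c j m + (1 - acc j m) * samplingCost q acc c e N (j + 1))

theorem exists_sum_mul_le [Nonempty M] [Fintype M] {v : M → ℝ} (hv : ∀ m, 0 ≤ v m)
    (c : M → ℝ) : ∃ m, (∑ m, v m) * c m ≤ ∑ m, v m * c m := by
  obtain ⟨m, hm⟩ := Finite.exists_min c
  refine ⟨m, ?_⟩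
  rw [Finset.sum_mul]
  exact Finset.sum_le_sum fun m' _ => mul_le_mul_of_nonneg_left (hm m') (hv m')

theorem exists_forall_sum_mul_le [Fintype I] [Nonempty M] [Fintype M] {v : I → M → ℝ}
    (hv : ∀ i m, 0 ≤ v i m) (c : I → M → ℝ) : ∃ choice : I → M,
      ∑ i, (∑ m, v i m) * c i (choice i) ≤ ∑ i, ∑ m, v i m * c i m := by
  choose choice hle using fun i => exists_sum_mul_le (hv i) (c i)
  exact ⟨choice, Finset.sum_le_sum fun i _ => hle i⟩

theorem exists_le_of_mem_stdSimplex [Fintype M] {q : M → ℝ} (hq : q ∈ stdSimplex ℝ M)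
    (c : M → ℝ) : ∃ m, c m ≤ ∑ m, q m * c m := by
  have hM : Nonempty M := by
    by_contra hM
    rw [not_nonempty_iff] at hM
    simpa using hq.2
  simpa only [hq.2, one_mul] using exists_sum_mul_le hq.1 c

-- The method of conditional expectations: the entries are fixed one after the other.
theorem exists_codebookCost_le [Fintype I] [Fintype M] {q : M → ℝ} (hq : q ∈ stdSimplex ℝ M)
    (acc c : I → ℕ → M → ℝ) (e u : I → ℝ) (N j : ℕ) :
    ∃ L : List M, L.length = N ∧
      ∑ i, u i * codebookCost (acc i) (c i) (e i) L j
        ≤ ∑ i, u i * samplingCost q (acc i) (c i) (e i) N j := by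
  induction N generalizing j u with
  | zero => exact ⟨[], rfl, le_rfl⟩
  | succ N ih =>
    obtain ⟨m, hm⟩ := exists_le_of_mem_stdSimplex hq fun m => ∑ i, u i *
      (acc i j m * c i j m + (1 - acc i j m) * samplingCost q (acc i) (c i) (e i) N (j + 1))
    obtain ⟨L, rfl, hL⟩ := ih (fun i => u i * (1 - acc i j m)) (j + 1)
    refine ⟨m :: L, rfl, ?_⟩
    calc ∑ i, u i * codebookCost (acc i) (c i) (e i) (m :: L) j
        = ∑ i, u i * (acc i j m * c i j m)
          + ∑ i, u i * (1 - acc i j m) * codebookCost (acc i) (c i) (e i) L (j + 1) := by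
          simp only [codebookCost, mul_add, mul_assoc, Finset.sum_add_distrib]
      _ ≤ ∑ i, u i * (acc i j m * c i j m) + ∑ i, u i * (1 - acc i j m) *
            samplingCost q (acc i) (c i) (e i) L.length (j + 1) := by gcongr
      _ = ∑ i, u i * (acc i j m * c i j m + (1 - acc i j m) *
            samplingCost q (acc i) (c i) (e i) L.length (j + 1)) := by
          simp only [mul_add, mul_assoc, Finset.sum_add_distrib]
      _ ≤ _ := hm
      _ = ∑ i, u i * samplingCost q (acc i) (c i) (e i) (L.length + 1) j := by
          simp only [samplingCost, Finset.mul_sum]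
          rw [Finset.sum_comm]
          simp only [mul_left_comm]

theorem exists_entry_le_codebookCost {acc : ℕ → M → ℝ} (hacc : ∀ n m, 0 ≤ acc n m)
    (hacc1 : ∀ n m, acc n m ≤ 1) (c : ℕ → M → ℝ) (e : ℝ) (L : List M) (j : ℕ) :
    e ≤ codebookCost acc c e L j ∨ ∃ (n : ℕ) (h : n < L.length),
      0 < acc (j + n) L[n] ∧ c (j + n) L[n] ≤ codebookCost acc c e L j := by
  induction L generalizing j with
  | nil => exact Or.inl le_rfl
  | cons m L ih =>
    set C := codebookCost acc c e (m :: L) j with hC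
    by_cases hm : 0 < acc j m ∧ c j m ≤ C
    · exact Or.inr ⟨0, by simp, hm⟩
    have hrest : codebookCost acc c e L (j + 1) ≤ C := by
      rw [codebookCost] at hC
      rcases (hacc j m).eq_or_lt with h0 | hpos
      · simp [hC, ← h0]
      · have hlt : C < c j m := not_le.1 fun h => hm ⟨hpos, h⟩
        by_contra! hgt
        nlinarith [mul_lt_mul_of_pos_left hlt hpos,
          mul_le_mul_of_nonneg_left hgt.le (sub_nonneg.2 (hacc1 j m))]
    rcases ih (j + 1) with he | ⟨n, hn, hpos, hle⟩
    · exact Or.inl (he.trans hrest)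
    · rw [add_assoc, add_comm 1 n] at hpos hle
      exact Or.inr ⟨n + 1, by simpa using hn, hpos, hle.trans hrest⟩

theorem residualMass_mul_samplingCost [Fintype M] {q p : M → ℝ} (hq : q ∈ stdSimplex ℝ M)
    (hp : ∀ m, 0 ≤ p m) (c : ℕ → M → ℝ) (e : ℝ) (N j : ℕ) :
    residualMass q p j * samplingCost q (acceptProb q p) c e N j
      = ∑ l ∈ Finset.Ico j (j + N), ∑ m, accepted q p l m * c l m
        + residualMass q p (j + N) * e := by
  induction N generalizing j with
  | zero => simp [samplingCost]
  | succ N ih =>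
    set S := samplingCost q (acceptProb q p) c e N (j + 1) with hS
    have hstep : residualMass q p j * samplingCost q (acceptProb q p) c e (N + 1) j
        = ∑ m, accepted q p j m * c j m + residualMass q p (j + 1) * S := by
      have hrej : ∑ m, (residualMass q p j * q m - accepted q p j m)
          = residualMass q p (j + 1) := by
        rw [Finset.sum_sub_distrib, ← Finset.mul_sum, hq.2, sum_accepted]
        ring
      rw [samplingCost, ← hS, ← hrej, Finset.mul_sum, Finset.sum_mul, ← Finset.sum_add_distrib]
      refine Finset.sum_congr rfl fun m _ => ?_
      rw [← residualMass_mul_acceptProb hq.1 hp]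
      ring
    rw [hstep, ih, ← add_assoc, Finset.sum_eq_sum_Ico_succ_bot (a := j) (by omega),
      add_right_comm j 1 N, ← add_assoc j]

end Codebook

/-! ### The expected codeword length -/

section Length

/-- The integral of `-logb 2` over `[0, t]`. -/
noncomputable def logPotential (t : ℝ) : ℝ := t * (1 - Real.log t) / Real.log 2

theorem logPotential_nonneg {t : ℝ} (h0 : 0 ≤ t) (h1 : t ≤ 1) : 0 ≤ logPotential t :=
  div_nonneg (mul_nonneg h0 (by linarith [Real.log_nonpos h0 h1])) (Real.log_nonneg one_le_two)

theorem logPotential_one : logPotential 1 = 1 / Real.log 2 := by simp [logPotential]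

theorem sub_mul_neg_logb_le {t t' : ℝ} (h0 : 0 ≤ t') (h1 : t' ≤ t) :
    (t - t') * -Real.logb 2 t ≤ logPotential t - logPotential t' := by
  have hlog : (t - t') * -Real.log t ≤ t * (1 - Real.log t) - t' * (1 - Real.log t') := by
    rcases h0.eq_or_lt with rfl | h0
    · linarith
    · have ht := h0.trans_le h1
      have hratio : Real.log t - Real.log t' ≤ t / t' - 1 := by
        rw [← Real.log_div ht.ne' h0.ne']
        exact Real.log_le_sub_one_of_pos (div_pos ht h0)
      have hscaled := mul_le_mul_of_nonneg_left hratio h0.le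
      rw [mul_sub t' (t / t'), mul_div_cancel₀ _ h0.ne'] at hscaled
      linarith
  have hlog2 : 0 < Real.log 2 := Real.log_pos one_lt_two
  rw [logPotential, logPotential, ← sub_div, Real.logb, ← neg_div, ← mul_div_assoc]
  exact div_le_div_of_nonneg_right hlog hlog2.le

variable {M : Type*} [Fintype M] {q p : M → ℝ}

theorem sum_mul_logb_one_add_le (hq : ∀ m, 0 ≤ q m) (hp : ∀ m, 0 ≤ p m)
    (hpq : ∀ m, 0 < p m → 0 < q m) :
    ∑ m, p m * Real.logb 2 (1 + p m / q m)
      ≤ ∑ m, p m * Real.logb 2 (p m / q m) + (∑ m, q m) / Real.log 2 := by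
  have hlog2 : 0 < Real.log 2 := Real.log_pos one_lt_two
  rw [Finset.sum_div, ← Finset.sum_add_distrib]
  refine Finset.sum_le_sum fun m _ => ?_
  rcases (hp m).eq_or_lt with h0 | hpm
  · rw [← h0, zero_mul, zero_mul, zero_add]
    exact div_nonneg (hq m) hlog2.le
  · have hqm := hpq m hpm
    have hfactor : 1 + p m / q m = p m / q m * (1 + q m / p m) := by field_simp; ring
    have hlog : p m * Real.log (1 + q m / p m) ≤ q m := by
      have := Real.log_le_sub_one_of_pos (by positivity : 0 < 1 + q m / p m)
      rw [add_sub_cancel_left] at this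
      rwa [← le_div_iff₀' hpm]
    rw [hfactor, Real.logb_mul (by positivity) (by positivity), mul_add]
    gcongr
    rw [Real.logb, ← mul_div_assoc]
    gcongr

theorem sum_mul_affine (hp1 : ∑ m, p m = 1) (u : M → ℝ) (a d : ℝ) :
    ∑ m, p m * (a * u m + d) = a * ∑ m, p m * u m + d := by
  simp only [mul_add, Finset.sum_add_distrib, mul_left_comm _ a, ← Finset.mul_sum,
    ← Finset.sum_mul, hp1, one_mul]

theorem sum_accepted_mul (g : M → ℝ) (N : ℕ) :
    ∑ n ∈ Finset.range N, ∑ m, accepted q p n m * g m = ∑ m, (p m - residual q p N m) * g m := by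
  rw [Finset.sum_comm]
  refine Finset.sum_congr rfl fun m _ => ?_
  rw [← Finset.sum_mul]
  simp only [accepted]
  rw [Finset.sum_range_sub' fun n => residual q p n m, residual]

variable (hq : ∀ m, 0 ≤ q m) (hp : p ∈ stdSimplex ℝ M)
include hq hp

theorem codeword_length_le_of_residual_pos {n : ℕ} {m : M} (hqm : 0 < q m)
    (h : 0 < residual q p n m) :
    ((codeword n).length : ℝ)
      ≤ 2 * Real.logb 2 (1 + p m / q m) + 3 + 2 * -Real.logb 2 (residualMass q p n) := by
  have hmass := residualMass_pos hp.1 h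
  have hratio : 0 ≤ p m / q m := div_nonneg (hp.1 m) hqm.le
  have hn : (n : ℝ) + 1 ≤ (1 + p m / q m) / residualMass q p n := by
    have hn : n * residualMass q p n ≤ p m / q m := by
      rw [le_div_iff₀ hqm]
      linarith [mul_residualMass_mul_add_residual_le hq hp.1 h]
    rw [le_div_iff₀ hmass]
    linarith [residualMass_le_one hq hp.1 hp.2 n]
  have hlog : Real.logb 2 (n + 1) ≤ Real.logb 2 ((1 + p m / q m) / residualMass q p n) :=
    Real.logb_le_logb_of_le one_lt_two (by positivity) hn
  rw [Real.logb_div (by positivity) hmass.ne'] at hlog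
  linarith [codeword_length_le n]

theorem mul_residualMass_mul_le_one {r : ℝ} (hr : ∀ m, 0 < p m → r ≤ q m) (n : ℕ) :
    n * residualMass q p n * r ≤ 1 := by
  rcases (residualMass_nonneg (q := q) hp.1 n).eq_or_lt with h0 | hmass
  · simp [← h0]
  obtain ⟨m, -, hm⟩ := Finset.exists_ne_zero_of_sum_ne_zero hmass.ne'
  have hm : 0 < residual q p n m := (residual_nonneg hp.1 n m).lt_of_ne' hm
  calc n * residualMass q p n * r ≤ n * residualMass q p n * q m := by
        gcongr
        exact hr m (hm.trans_le (residual_le hq hp.1 n m))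
    _ ≤ p m := by linarith [mul_residualMass_mul_add_residual_le hq hp.1 hm]
    _ ≤ 1 := hp.2 ▸ Finset.single_le_sum (fun m _ => hp.1 m) (Finset.mem_univ m)

variable (hpq : ∀ m, 0 < p m → 0 < q m)
include hpq

theorem sum_accepted_mul_codeword_length_le (n : ℕ) :
    ∑ m, accepted q p n m * (codeword n).length
      ≤ ∑ m, accepted q p n m * (2 * Real.logb 2 (1 + p m / q m) + 3)
        + 2 * (logPotential (residualMass q p n) - logPotential (residualMass q p (n + 1))) := by
  have hlength : ∀ m, accepted q p n m * (codeword n).length ≤ accepted q p n m *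
      (2 * Real.logb 2 (1 + p m / q m) + 3 + 2 * -Real.logb 2 (residualMass q p n)) := by
    intro m
    rcases (accepted_nonneg hq hp.1 n m).eq_or_lt with h0 | hacc
    · rw [← h0, zero_mul, zero_mul]
    · have hres := residual_pos_of_accepted_pos hp.1 hacc
      exact mul_le_mul_of_nonneg_left (codeword_length_le_of_residual_pos hq hp
        (hpq m (hres.trans_le (residual_le hq hp.1 n m))) hres) hacc.le
  refine (Finset.sum_le_sum fun m _ => hlength m).trans ?_
  simp only [mul_add (accepted q p n _) _ (2 * -Real.logb 2 _), Finset.sum_add_distrib,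
    ← Finset.sum_mul, sum_accepted]
  linarith [sub_mul_neg_logb_le (residualMass_nonneg hp.1 (n + 1))
    (residualMass_succ_le hq hp.1 n)]

theorem sum_range_accepted_mul_codeword_length_le (N : ℕ) :
    ∑ n ∈ Finset.range N, ∑ m, accepted q p n m * (codeword n).length
      ≤ ∑ m, p m * (2 * Real.logb 2 (1 + p m / q m) + 3) + 2 / Real.log 2 := by
  have hmass0 : residualMass q p 0 = 1 := hp.2
  have hpot := logPotential_nonneg (residualMass_nonneg hp.1 N)
    (residualMass_le_one hq hp.1 hp.2 N)
  have hres : ∑ m, (p m - residual q p N m) * (2 * Real.logb 2 (1 + p m / q m) + 3)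
      ≤ ∑ m, p m * (2 * Real.logb 2 (1 + p m / q m) + 3) := by
    refine Finset.sum_le_sum fun m _ => mul_le_mul_of_nonneg_right
      (sub_le_self _ (residual_nonneg hp.1 N m)) ?_
    have := Real.logb_nonneg one_lt_two
      (le_add_of_nonneg_right (div_nonneg (hp.1 m) (hq m)) : (1 : ℝ) ≤ 1 + p m / q m)
    positivity
  have hsum := Finset.sum_le_sum fun n (_ : n ∈ Finset.range N) =>
    sum_accepted_mul_codeword_length_le hq hp hpq n
  rw [Finset.sum_add_distrib, sum_accepted_mul, ← Finset.mul_sum,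
    Finset.sum_range_sub' fun n => logPotential (residualMass q p n), hmass0,
    logPotential_one] at hsum
  linarith [mul_one_div 2 (Real.log 2)]

end Length

/-! ### Compression of one message -/

section Code

variable {I M : Type*} [Fintype M]

theorem samplingCost_acceptProb_le {q p : M → ℝ} (hq : q ∈ stdSimplex ℝ M)
    (hp : p ∈ stdSimplex ℝ M) (hpq : ∀ m, 0 < p m → 0 < q m) {lam : ℝ} (hlam : 0 ≤ lam)
    {g : M → ℝ} {g₀ : ℝ} (hg : ∀ m, 0 < p m → g₀ ≤ g m) {τ : ℝ} {N : ℕ}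
    (hτ : residualMass q p N * τ ≤ 1) :
    samplingCost q (acceptProb q p) (fun n m => lam * (codeword n).length + g m)
        (lam * τ + g₀) N 0
      ≤ ∑ m, p m * (lam * (2 * Real.logb 2 (p m / q m) + 10) + g m) := by
  have hmass0 : residualMass q p 0 = 1 := hp.2
  have hcost := residualMass_mul_samplingCost hq hp.1
    (fun n m => lam * (codeword n).length + g m) (lam * τ + g₀) N 0
  rw [hmass0, one_mul, zero_add, ← Finset.range_eq_Ico] at hcost
  simp only [mul_add, Finset.sum_add_distrib, sum_accepted_mul, mul_left_comm _ lam,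
    ← Finset.mul_sum] at hcost
  have hg₀ : residualMass q p N * g₀ ≤ ∑ m, residual q p N m * g m := by
    rw [residualMass, Finset.sum_mul]
    refine Finset.sum_le_sum fun m _ => ?_
    rcases (residual_nonneg (q := q) hp.1 N m).eq_or_lt with h0 | hres
    · rw [← h0, zero_mul, zero_mul]
    · exact mul_le_mul_of_nonneg_left (hg m (hres.trans_le (residual_le hq.1 hp.1 N m))) hres.le
  have hlength : ∑ n ∈ Finset.range N, ∑ m, accepted q p n m * (codeword n).length
      + residualMass q p N * τ ≤ 2 * ∑ m, p m * Real.logb 2 (p m / q m) + 10 := by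
    have hlog2 : 1 / Real.log 2 ≤ 3 / 2 := by
      rw [div_le_div_iff₀ (Real.log_pos one_lt_two) two_pos]
      linarith [Real.log_two_gt_d9]
    have h := sum_range_accepted_mul_codeword_length_le hq.1 hp hpq N
    have hlogb := sum_mul_logb_one_add_le hq.1 hp.1 hpq
    rw [sum_mul_affine hp.2] at h
    rw [hq.2] at hlogb
    linarith [mul_one_div 2 (Real.log 2)]
  simp only [sub_mul, Finset.sum_sub_distrib] at hcost
  simp only [mul_add _ (lam * _), Finset.sum_add_distrib, mul_left_comm _ lam, ← Finset.mul_sum,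
    sum_mul_affine hp.2]
  rw [hcost]
  linarith [mul_le_mul_of_nonneg_left hlength hlam]

theorem exists_pos_of_mem_stdSimplex {p : M → ℝ} (hp : p ∈ stdSimplex ℝ M) : ∃ m, 0 < p m := by
  obtain ⟨m, -, hm⟩ := Finset.exists_ne_zero_of_sum_ne_zero (hp.2 ▸ one_ne_zero)
  exact ⟨m, (hp.1 m).lt_of_ne' hm⟩

-- A reader who accepts none of the samples finds every value in the list appended to them.
theorem exists_getElem?_eq_some_le_codebookCost {q p : M → ℝ} (hq : ∀ m, 0 ≤ q m)
    (hp : ∀ m, 0 ≤ p m) {m₀ : M} (hm₀ : 0 < p m₀) {lam : ℝ} (hlam : 0 ≤ lam) (g : M → ℝ)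
    (L : List M) {τ : ℝ} (hτ : ∀ n < L.length + Fintype.card M, ((codeword n).length : ℝ) ≤ τ) :
    ∃ (n : ℕ) (m : M), (L ++ Finset.univ.toList)[n]? = some m ∧ 0 < p m ∧
      lam * (codeword n).length + g m ≤ codebookCost (acceptProb q p)
        (fun n m => lam * (codeword n).length + g m) (lam * τ + g m₀) L 0 := by
  rcases exists_entry_le_codebookCost (acceptProb_nonneg hq hp) (acceptProb_le_one hq hp)
    (fun n m => lam * (codeword n).length + g m) (lam * τ + g m₀) L 0
    with hle | ⟨n, hn, hpos, hle⟩
  · obtain ⟨n, hn, hnm⟩ := List.getElem_of_mem (Finset.mem_toList.2 (Finset.mem_univ m₀))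
    refine ⟨L.length + n, m₀, ?_, hm₀, le_trans ?_ hle⟩
    · rw [List.getElem?_append_right (Nat.le_add_right _ _), Nat.add_sub_cancel_left,
        List.getElem?_eq_getElem hn, hnm]
    · gcongr
      exact hτ _ (by simpa using hn)
  · rw [zero_add] at hpos hle
    refine ⟨n, L[n], ?_, pos_of_acceptProb_pos hq hp hpos, hle⟩
    rw [List.getElem?_append_left hn, List.getElem?_eq_getElem hn]

variable [Fintype I]

theorem exists_codebook {q : M → ℝ} (hq : q ∈ stdSimplex ℝ M) {p : I → M → ℝ}
    (hp : ∀ i, p i ∈ stdSimplex ℝ M) (hpq : ∀ i m, 0 < p i m → 0 < q m)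
    {V : I → ℝ} (hV : ∀ i, 0 ≤ V i) {lam : ℝ} (hlam : 0 ≤ lam) (g : I → M → ℝ) :
    ∃ (C : ℕ → M) (sel : I → ℕ), (∀ i, 0 < p i (C (sel i))) ∧
      ∑ i, V i * (lam * (codeword (sel i)).length + g i (C (sel i)))
        ≤ ∑ i, V i * ∑ m, p i m * (lam * (2 * Real.logb 2 (p i m / q m) + 10) + g i m) := by
  obtain ⟨r, hr, hrpos⟩ : ∃ r : ℝ, (∀ m, 0 < q m → r ≤ q m) ∧ 0 < r :=
    ((Filter.eventually_all.2 fun m => Filter.eventually_imp_distrib_left.2 fun hqm =>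
      nhdsWithin_le_nhds (eventually_le_nhds hqm)).and
      (self_mem_nhdsWithin : Set.Ioi (0 : ℝ) ∈ nhdsWithin 0 (Set.Ioi 0))).exists
  obtain ⟨J, hJ⟩ := exists_codeword_length_le_mul (Fintype.card M) hrpos
  choose m₀ hm₀ hmin using fun i => Set.exists_min_image {m | 0 < p i m} (g i) (Set.toFinite _)
    (exists_pos_of_mem_stdSimplex (hp i))
  obtain ⟨L, rfl, hL⟩ := exists_codebookCost_le hq (fun i => acceptProb q (p i))
    (fun i n m => lam * (codeword n).length + g i m) (fun i => lam * (r * J) + g i (m₀ i)) V J 0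
  choose sel m hC hpos hle using fun i =>
    exists_getElem?_eq_some_le_codebookCost hq.1 (hp i).1 (hm₀ i) hlam (g i) L hJ
  obtain ⟨m₁, -⟩ := exists_pos_of_mem_stdSimplex hq
  refine ⟨fun n => ((L ++ Finset.univ.toList)[n]?).getD m₁, sel,
    fun i => by simpa [hC] using hpos i, ?_⟩
  simp only [hC, Option.getD_some]
  refine (Finset.sum_le_sum fun i _ => mul_le_mul_of_nonneg_left (hle i) (hV i)).trans
    (hL.trans (Finset.sum_le_sum fun i _ => mul_le_mul_of_nonneg_left ?_ (hV i)))
  refine samplingCost_acceptProb_le hq (hp i) (hpq i) hlam (hmin i) ?_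
  linarith [mul_residualMass_mul_le_one hq.1 (hp i) (fun m hm => hr m (hpq i m hm)) L.length]

theorem exists_mem_stdSimplex_ge [Nonempty M] {q : M → ℝ} (hq : ∀ m, 0 ≤ q m)
    (hq1 : ∑ m, q m ≤ 1) : ∃ q' ∈ stdSimplex ℝ M, ∀ m, q m ≤ q' m := by
  have hrest : 0 ≤ (1 - ∑ m, q m) / Fintype.card M :=
    div_nonneg (sub_nonneg.2 hq1) (Nat.cast_nonneg _)
  refine ⟨fun m => q m + (1 - ∑ m, q m) / Fintype.card M,
    ⟨fun m => add_nonneg (hq m) hrest, ?_⟩, fun m => le_add_of_nonneg_right hrest⟩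
  rw [Finset.sum_add_distrib, Finset.sum_const, Finset.card_univ, nsmul_eq_mul,
    mul_div_cancel₀ _ (Nat.cast_ne_zero.2 Fintype.card_ne_zero), add_sub_cancel]

theorem exists_mem_stdSimplex_eq_sum_mul {q v : M → ℝ} (hq : q ∈ stdSimplex ℝ M)
    (hv : ∀ m, 0 ≤ v m) (hvq : ∀ m, 0 < v m → 0 < q m) :
    ∃ p ∈ stdSimplex ℝ M, (∀ m, v m = (∑ m', v m') * p m) ∧ ∀ m, 0 < p m → 0 < q m := by
  have hV : 0 ≤ ∑ m, v m := Finset.sum_nonneg fun m _ => hv m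
  rcases hV.eq_or_lt with h0 | hV
  · refine ⟨q, hq, fun m => ?_, fun _ => id⟩
    rw [← h0, zero_mul]
    exact (Finset.sum_eq_zero_iff_of_nonneg fun m _ => hv m).1 h0.symm m (Finset.mem_univ m)
  · refine ⟨fun m => v m / ∑ m', v m', ⟨fun m => div_nonneg (hv m) hV.le, ?_⟩,
      fun m => (mul_div_cancel₀ _ hV.ne').symm, fun m hpos => hvq m ?_⟩
    · rw [← Finset.sum_div, div_self hV.ne']
    · exact (div_pos_iff_of_pos_right hV).1 hpos

theorem exists_code_of_weights [Nonempty M] {q : M → ℝ} (hq : ∀ m, 0 ≤ q m)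
    (hq1 : ∑ m, q m ≤ 1) {v : I → M → ℝ} (hv : ∀ i m, 0 ≤ v i m)
    (hvq : ∀ i m, 0 < v i m → 0 < q m) {D : I → M → ℝ} (hD : ∀ i m, v i m = 0 → D i m = 0)
    {lam : ℝ} (hlam : 0 ≤ lam) :
    ∃ (enc : I → Message) (dec : Message → M), (∀ i i', enc i <+: enc i' → enc i = enc i') ∧
      (∀ i, 0 < ∑ m, v i m → 0 < v i (dec (enc i))) ∧
      ∑ i, (∑ m, v i m) * (lam * (enc i).length + D i (dec (enc i)) / v i (dec (enc i)))
        ≤ ∑ i, ∑ m, (v i m * (lam * (2 * Real.logb 2 (v i m / (∑ m', v i m') / q m) + 10))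
          + D i m) := by
  obtain ⟨q', hq', hqq'⟩ := exists_mem_stdSimplex_ge hq hq1
  choose p hp hvp hpq using fun i => exists_mem_stdSimplex_eq_sum_mul hq' (hv i)
    fun m hvm => (hvq i m hvm).trans_le (hqq' m)
  have hV : ∀ i, 0 ≤ ∑ m, v i m := fun i => Finset.sum_nonneg fun m _ => hv i m
  obtain ⟨C, sel, hC, hle⟩ := exists_codebook hq' hp hpq hV hlam fun i m => D i m / v i m
  refine ⟨fun i => codeword (sel i), fun w => C (Function.invFun codeword w),
    fun i i' h => congrArg codeword (eq_of_codeword_prefix h), ?_, ?_⟩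
  all_goals simp only [Function.leftInverse_invFun codeword_injective _]
  · exact fun i hi => hvp i _ ▸ mul_pos hi (hC i)
  refine hle.trans (Finset.sum_le_sum fun i _ => ?_)
  rw [Finset.mul_sum]
  refine Finset.sum_le_sum fun m _ => ?_
  rw [← mul_assoc, ← hvp]
  rcases (hv i m).eq_or_lt with h0 | hvm
  · rw [hD i m h0.symm, ← h0, zero_mul, zero_mul, add_zero]
  have hVi : 0 < ∑ m', v i m' :=
    Finset.sum_pos' (fun m _ => hv i m) ⟨m, Finset.mem_univ m, hvm⟩
  have hpm : p i m = v i m / ∑ m', v i m' :=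
    (eq_div_iff_mul_eq hVi.ne').2 ((mul_comm _ _).trans (hvp i m).symm)
  have hqm := hvq i m hvm
  rw [mul_add, mul_div_cancel₀ _ hvm.ne', hpm]
  gcongr
  · exact one_lt_two
  · exact div_pos (div_pos hvm hVi) (hqm.trans_le (hqq' m))
  · exact hqq' m

end Code

/-! ### Protocols -/

@[simp] theorem Party.other_other (a : Party) : a.other.other = a := by cases a <;> rfl

theorem speaker_zero (first : Party) : speaker first 0 = first := by simp [speaker]

theorem speaker_succ (first : Party) (i : ℕ) :
    speaker first (i + 1) = speaker first.other i := by
  unfold speaker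
  by_cases h : Even i
  · rw [if_pos h, if_neg (by simpa [Nat.even_add_one] using h)]
  · rw [if_neg h, if_pos (by simpa [Nat.even_add_one] using h), Party.other_other]

theorem speaker_other (first : Party) (i : ℕ) :
    speaker first.other i = (speaker first i).other := by
  unfold speaker
  split_ifs <;> simp

namespace Protocol

variable {X Y Z : Type*} {k : ℕ} {first : Party}

/-- What remains of a protocol after the first message `m`. -/
def tail (P : Protocol X Y Z (k + 1) first) (m : Message) : Protocol X Y Z k first.other where
  msgAlice x h := P.msgAlice x (m :: h)
  msgBob y h := P.msgBob y (m :: h)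
  outAlice x h := P.outAlice x (m :: h)
  outBob y h := P.outBob y (m :: h)
  outTranscript h := P.outTranscript (m :: h)

theorem history_succ_eq_cons (P : Protocol X Y Z (k + 1) first) (x : X) (y : Y) (i : ℕ) :
    P.history x y (i + 1)
      = P.msg x y [] first :: (P.tail (P.msg x y [] first)).history x y i := by
  induction i with
  | zero => simp [history, speaker_zero]
  | succ i ih =>
    rw [history, ih, history, speaker_succ]
    cases speaker first.other i <;> rfl

theorem transcript_eq_cons (P : Protocol X Y Z (k + 1) first) (x : X) (y : Y) :
    P.transcript x y
      = P.msg x y [] first :: (P.tail (P.msg x y [] first)).transcript x y :=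
  P.history_succ_eq_cons x y k

theorem output_eq_tail (P : Protocol X Y Z (k + 1) first) (x : X) (y : Y) (o : Answerer) :
    P.output x y o = (P.tail (P.msg x y [] first)).output x y o := by
  cases o <;> simp [output, transcript_eq_cons, tail]

theorem bits_eq_tail (P : Protocol X Y Z (k + 1) first) (x : X) (y : Y) :
    P.bits x y = (P.msg x y [] first).length + (P.tail (P.msg x y [] first)).bits x y := by
  simp [bits, transcript_eq_cons]

theorem history_length (P : Protocol X Y Z k first) (x : X) (y : Y) (i : ℕ) :
    (P.history x y i).length = i := by
  induction i with
  | zero => rfl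
  | succ i ih => simp [history, ih]

theorem transcript_length (P : Protocol X Y Z k first) (x : X) (y : Y) :
    (P.transcript x y).length = k := P.history_length x y k

/-- The protocol in which Alice first sends `c x`, and after this message `m` the players follow the
protocol `rest m`. Its behaviour after the empty history, where Bob does not send and nobody
answers, is arbitrary. -/
def consAlice (c : X → Message) (rest : Message → Protocol X Y Z k .bob) :
    Protocol X Y Z (k + 1) .alice where
  msgAlice x h := match h with
    | [] => c x
    | m :: h => (rest m).msgAlice x h
  msgBob y h := match h with
    | [] => []
    | m :: h => (rest m).msgBob y h
  outAlice x h := match h with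
    | [] => (rest []).outAlice x []
    | m :: h => (rest m).outAlice x h
  outBob y h := match h with
    | [] => (rest []).outBob y []
    | m :: h => (rest m).outBob y h
  outTranscript h := match h with
    | [] => (rest []).outTranscript []
    | m :: h => (rest m).outTranscript h

theorem prefixFree_consAlice {c : X → Message} {rest : Message → Protocol X Y Z k .bob}
    (hc : ∀ x x', c x <+: c x' → c x = c x') (hr : ∀ m, (rest m).PrefixFree) :
    (consAlice c rest).PrefixFree := by
  refine ⟨fun h x x' => ?_, fun h y y' => ?_⟩
  · cases h with
    | nil => exact hc x x'
    | cons m h => exact (hr m).1 h x x'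
  · cases h with
    | nil => exact fun _ => rfl
    | cons m h => exact (hr m).2 h _ _

/-- The protocol with the names of the players exchanged, so that what is proved about Alice's
messages also holds for Bob's. -/
def swap (P : Protocol X Y Z k first) : Protocol Y X Z k first.other where
  msgAlice := P.msgBob
  msgBob := P.msgAlice
  outAlice := P.outBob
  outBob := P.outAlice
  outTranscript := P.outTranscript

end Protocol

/-- The name of an answerer after the players have exchanged their names. -/
def Answerer.swap : Answerer → Answerer
  | .alice => .bob
  | .bob => .alice
  | .transcript => .transcript

@[simp] theorem Answerer.swap_swap (o : Answerer) : o.swap.swap = o := by cases o <;> rfl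

namespace Protocol

variable {X Y Z : Type*} {k : ℕ} {first : Party}

theorem history_swap (P : Protocol X Y Z k first) (x : X) (y : Y) (i : ℕ) :
    P.swap.history y x i = P.history x y i := by
  induction i with
  | zero => rfl
  | succ i ih =>
    rw [history, history, ih, speaker_other]
    cases speaker first i <;> rfl

theorem transcript_swap (P : Protocol X Y Z k first) (x : X) (y : Y) :
    P.swap.transcript y x = P.transcript x y := P.history_swap x y k

theorem output_swap (P : Protocol X Y Z k first) (x : X) (y : Y) (o : Answerer) :
    P.swap.output y x o = P.output x y o.swap := by
  cases o <;> simp only [output, transcript_swap, Answerer.swap] <;> rfl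

theorem bits_swap (P : Protocol X Y Z k first) (x : X) (y : Y) :
    P.swap.bits y x = P.bits x y := by
  rw [bits, bits, transcript_swap]

open Classical in
/-- The indicator of a wrong answer: `1` if some answerer in `A` does not answer `f x y`,
else `0`. -/
noncomputable def failure (P : Protocol X Y Z k first) (A : Set Answerer) (f : X → Y → Z)
    (x : X) (y : Y) : ℝ :=
  if ∀ o ∈ A, P.output x y o = f x y then 0 else 1

theorem failure_congr {X' Y' : Type*} {k' : ℕ} {first' : Party} {P : Protocol X Y Z k first}
    {P' : Protocol X' Y' Z k' first'} {A A' : Set Answerer} {f : X → Y → Z} {f' : X' → Y' → Z}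
    {x : X} {y : Y} {x' : X'} {y' : Y'}
    (h : (∀ o ∈ A, P.output x y o = f x y) ↔ ∀ o ∈ A', P'.output x' y' o = f' x' y') :
    P.failure A f x y = P'.failure A' f' x' y' := by
  unfold failure
  by_cases hA : ∀ o ∈ A, P.output x y o = f x y
  · rw [if_pos hA, if_pos (h.1 hA)]
  · rw [if_neg hA, if_neg (mt h.2 hA)]

theorem failure_nonneg (P : Protocol X Y Z k first) (A : Set Answerer) (f : X → Y → Z)
    (x : X) (y : Y) : 0 ≤ P.failure A f x y := by
  unfold failure
  split_ifs <;> norm_num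

theorem failure_le_one (P : Protocol X Y Z k first) (A : Set Answerer) (f : X → Y → Z)
    (x : X) (y : Y) : P.failure A f x y ≤ 1 := by
  unfold failure
  split_ifs <;> norm_num

/-- The failure indicator plus `lam` times the number of bits exchanged: the quantity whose average
is kept small while the messages are compressed one after the other. -/
noncomputable def loss (P : Protocol X Y Z k first) (A : Set Answerer) (f : X → Y → Z)
    (lam : ℝ) (x : X) (y : Y) : ℝ :=
  P.failure A f x y + lam * (P.bits x y : ℝ)

theorem failure_eq_tail (P : Protocol X Y Z (k + 1) first) (A : Set Answerer) (f : X → Y → Z)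
    (x : X) (y : Y) :
    P.failure A f x y = (P.tail (P.msg x y [] first)).failure A f x y :=
  failure_congr (by simp only [output_eq_tail])

theorem loss_eq_tail (P : Protocol X Y Z (k + 1) first) (A : Set Answerer) (f : X → Y → Z)
    (lam : ℝ) (x : X) (y : Y) :
    P.loss A f lam x y = lam * ((P.msg x y [] first).length : ℝ)
      + (P.tail (P.msg x y [] first)).loss A f lam x y := by
  rw [loss, loss, failure_eq_tail, bits_eq_tail]
  push_cast
  ring

theorem loss_consAlice (c : X → Message) (rest : Message → Protocol X Y Z k .bob)
    (A : Set Answerer) (f : X → Y → Z) (lam : ℝ) (x : X) (y : Y) :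
    (consAlice c rest).loss A f lam x y
      = lam * ((c x).length : ℝ) + (rest (c x)).loss A f lam x y :=
  loss_eq_tail ..

theorem failure_swap (P : Protocol X Y Z k first) (A : Set Answerer) (f : X → Y → Z)
    (x : X) (y : Y) :
    P.swap.failure (Answerer.swap ⁻¹' A) (fun y x => f x y) y x = P.failure A f x y := by
  have hanswers : (∀ o ∈ Answerer.swap ⁻¹' A, P.swap.output y x o = f x y) ↔
      ∀ o ∈ A, P.output x y o = f x y := by
    simp only [output_swap, Set.mem_preimage]
    exact ⟨fun h o ho => by simpa using h o.swap (by simpa using ho), fun h o ho => h _ ho⟩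
  exact failure_congr hanswers

theorem loss_swap (P : Protocol X Y Z k first) (A : Set Answerer) (f : X → Y → Z)
    (lam : ℝ) (x : X) (y : Y) :
    P.swap.loss (Answerer.swap ⁻¹' A) (fun y x => f x y) lam y x = P.loss A f lam x y := by
  rw [loss, loss, failure_swap, bits_swap]

/-- The number of bits that have been exchanged when the history is `h`. -/
def bitCount (h : History) : ℕ := (h.map List.length).sum

/-- The protocol in which the players fall silent, in the middle of a message if necessary, as soon
as `B` bits have been exchanged. -/
def truncate (P : Protocol X Y Z k first) (B : ℕ) : Protocol X Y Z k first where
  msgAlice x h := (P.msgAlice x h).take (B - bitCount h)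
  msgBob y h := (P.msgBob y h).take (B - bitCount h)
  outAlice := P.outAlice
  outBob := P.outBob
  outTranscript := P.outTranscript

theorem eq_of_take_prefix_take {l l' : Message} (n : ℕ) (h : l <+: l' → l = l')
    (ht : l.take n <+: l'.take n) : l.take n = l'.take n := by
  rcases le_or_gt l.length n with hl | hl
  · rw [List.take_of_length_le hl] at ht
    rw [h (ht.trans (List.take_prefix _ _))]
  · refine ht.eq_of_length_le ?_
    simp only [List.length_take]
    omega

theorem PrefixFree.truncate {P : Protocol X Y Z k first} (h : P.PrefixFree) (B : ℕ) :
    (P.truncate B).PrefixFree :=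
  ⟨fun hist x x' => eq_of_take_prefix_take _ (h.1 hist x x'),
    fun hist y y' => eq_of_take_prefix_take _ (h.2 hist y y')⟩

theorem msg_truncate (P : Protocol X Y Z k first) (B : ℕ) (x : X) (y : Y) (h : History)
    (a : Party) : (P.truncate B).msg x y h a = (P.msg x y h a).take (B - bitCount h) := by
  cases a <;> rfl

theorem bitCount_append_singleton (h : History) (m : Message) :
    bitCount (h ++ [m]) = bitCount h + m.length := by
  simp [bitCount]

theorem bits_truncate_le (P : Protocol X Y Z k first) (B : ℕ) (x : X) (y : Y) :
    (P.truncate B).bits x y ≤ B := by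
  have hbits : ∀ i, bitCount ((P.truncate B).history x y i) ≤ B := by
    intro i
    induction i with
    | zero => simp [bitCount, history]
    | succ i ih =>
      rw [history, bitCount_append_singleton, msg_truncate, List.length_take]
      omega
  exact hbits k

theorem history_truncate (P : Protocol X Y Z k first) {B : ℕ} {x : X} {y : Y} {i : ℕ}
    (h : bitCount (P.history x y i) ≤ B) : (P.truncate B).history x y i = P.history x y i := by
  induction i with
  | zero => rfl
  | succ i ih =>
    rw [history, bitCount_append_singleton] at h
    rw [history, history, ih (by omega), msg_truncate, List.take_of_length_le (by omega)]

theorem output_truncate (P : Protocol X Y Z k first) {B : ℕ} {x : X} {y : Y}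
    (h : P.bits x y ≤ B) (o : Answerer) : (P.truncate B).output x y o = P.output x y o := by
  have htranscript : (P.truncate B).transcript x y = P.transcript x y := P.history_truncate h
  cases o <;> simp only [output, htranscript] <;> rfl

theorem failure_truncate_le (P : Protocol X Y Z k first) (A : Set Answerer) (f : X → Y → Z)
    {B : ℕ} {lam : ℝ} (hlam : 0 ≤ lam) {x : X} {y : Y}
    (h : B < P.bits x y → 1 ≤ lam * P.bits x y) :
    (P.truncate B).failure A f x y ≤ P.loss A f lam x y := by
  rw [loss]
  rcases le_or_gt (P.bits x y) B with hB | hB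
  · have hfail : (P.truncate B).failure A f x y = P.failure A f x y :=
      failure_congr (by simp only [P.output_truncate hB])
    rw [hfail]
    exact le_add_of_nonneg_right (by positivity)
  · linarith [h hB, (P.truncate B).failure_le_one A f x y, P.failure_nonneg A f x y]

end Protocol

/-! ### Compression of all messages -/

/-- A protocol with private coins whose laws may depend on the input of their owner and need not be
normalised: conditioning on the first message turns a private coin protocol into such a thing. -/
structure WeightedProtocol (X Y Z R S : Type*) (k : ℕ) (first : Party) where
  act : Protocol (X × R) (Y × S) Z k first
  coinAlice : X → R → ℝ
  coinBob : Y → S → ℝ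
  coinAlice_nonneg : ∀ x r, 0 ≤ coinAlice x r
  coinBob_nonneg : ∀ y s, 0 ≤ coinBob y s

/-- A system of weights of transcript prefixes: the weight of a prefix is at least the total weight
of the prefixes that are longer by one message. It stands for the receivers' prediction of the
transcript, which knows neither input. -/
structure IsSemimeasure (Q : History → ℝ) : Prop where
  nonneg : ∀ h, 0 ≤ Q h
  sum_append_le : ∀ (h : History) (F : Finset Message), ∑ m ∈ F, Q (h ++ [m]) ≤ Q h

namespace IsSemimeasure

variable {Q : History → ℝ}

theorem append_le (hQ : IsSemimeasure Q) (h t : History) : Q (h ++ t) ≤ Q h := by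
  induction t generalizing h with
  | nil => simp
  | cons m t ih =>
    have hm : Q (h ++ [m]) ≤ Q h := by simpa using hQ.sum_append_le h {m}
    simpa using (ih (h ++ [m])).trans hm

theorem cons (hQ : IsSemimeasure Q) (m : Message) : IsSemimeasure fun h => Q (m :: h) :=
  ⟨fun h => hQ.nonneg (m :: h), fun h => hQ.sum_append_le (m :: h)⟩

end IsSemimeasure

namespace WeightedProtocol

variable {X Y Z R S : Type*} {k : ℕ} {first : Party}

/-- The weight of the coins `r`, `s` on inputs `x`, `y`. -/
def weight (G : WeightedProtocol X Y Z R S k first) (x : X) (y : Y) (r : R) (s : S) : ℝ :=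
  G.coinAlice x r * G.coinBob y s

/-- The transcript on inputs `x`, `y` and coins `r`, `s`. -/
def transcript (G : WeightedProtocol X Y Z R S k first) (x : X) (y : Y) (r : R) (s : S) :
    History :=
  G.act.transcript (x, r) (y, s)

/-- The transcripts that occur on inputs `x`, `y` have positive weight in `Q`. -/
def DominatedBy (G : WeightedProtocol X Y Z R S k first) (Q : History → ℝ) (x : X) (y : Y) :
    Prop :=
  ∀ r s, 0 < G.weight x y r s → 0 < Q (G.transcript x y r s)

/-- The weighted protocol with the names of the players exchanged. -/
def swap (G : WeightedProtocol X Y Z R S k first) :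
    WeightedProtocol Y X Z S R k first.other where
  act := G.act.swap
  coinAlice := G.coinBob
  coinBob := G.coinAlice
  coinAlice_nonneg := G.coinBob_nonneg
  coinBob_nonneg := G.coinAlice_nonneg

open Classical in
/-- What remains of the weighted protocol if Alice's first message is `m`: her coins keep their
weights if they produce this message and get weight `0` otherwise. -/
noncomputable def afterMessage (G : WeightedProtocol X Y Z R S (k + 1) .alice) (m : Message) :
    WeightedProtocol X Y Z R S k .bob where
  act := G.act.tail m
  coinAlice x r := if G.act.msgAlice (x, r) [] = m then G.coinAlice x r else 0
  coinBob := G.coinBob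
  coinAlice_nonneg x r := by split_ifs; exacts [G.coinAlice_nonneg x r, le_rfl]
  coinBob_nonneg := G.coinBob_nonneg

theorem weight_nonneg (G : WeightedProtocol X Y Z R S k first) (x : X) (y : Y) (r : R) (s : S) :
    0 ≤ G.weight x y r s :=
  mul_nonneg (G.coinAlice_nonneg x r) (G.coinBob_nonneg y s)

theorem weight_swap (G : WeightedProtocol X Y Z R S k first) (x : X) (y : Y) (r : R) (s : S) :
    G.swap.weight y x s r = G.weight x y r s :=
  mul_comm _ _

theorem transcript_swap (G : WeightedProtocol X Y Z R S k first) (x : X) (y : Y) (r : R) (s : S) :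
    G.swap.transcript y x s r = G.transcript x y r s :=
  G.act.transcript_swap (x, r) (y, s)

theorem DominatedBy.swap {G : WeightedProtocol X Y Z R S k first} {Q : History → ℝ} {x : X} {y : Y}
    (h : G.DominatedBy Q x y) : G.swap.DominatedBy Q y x := fun s r hrs => by
  rw [transcript_swap]
  exact h r s (by rwa [weight_swap] at hrs)

open Classical in
theorem weight_afterMessage (G : WeightedProtocol X Y Z R S (k + 1) .alice) (m : Message)
    (x : X) (y : Y) (r : R) (s : S) :
    (G.afterMessage m).weight x y r s
      = if G.act.msgAlice (x, r) [] = m then G.weight x y r s else 0 := by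
  simp only [weight, afterMessage, ite_mul, zero_mul]

theorem transcript_eq_cons (G : WeightedProtocol X Y Z R S (k + 1) .alice)
    (x : X) (y : Y) (r : R) (s : S) :
    G.transcript x y r s = G.act.msgAlice (x, r) []
      :: (G.afterMessage (G.act.msgAlice (x, r) [])).transcript x y r s :=
  G.act.transcript_eq_cons (x, r) (y, s)

theorem DominatedBy.afterMessage {G : WeightedProtocol X Y Z R S (k + 1) .alice} {Q : History → ℝ}
    {x : X} {y : Y} (h : G.DominatedBy Q x y) (m : Message) :
    (G.afterMessage m).DominatedBy (fun t => Q (m :: t)) x y := by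
  intro r s hrs
  rw [weight_afterMessage] at hrs
  split_ifs at hrs with hm
  · have hQ := h r s hrs
    rwa [transcript_eq_cons, hm] at hQ
  · exact absurd hrs (lt_irrefl 0)

open Classical in
/-- The messages with which Alice may start. -/
noncomputable def firstMessages [Fintype X] [Fintype R]
    (G : WeightedProtocol X Y Z R S (k + 1) .alice) : Finset Message :=
  Finset.univ.image fun z => G.act.msgAlice z []

theorem msgAlice_mem_firstMessages [Fintype X] [Fintype R]
    (G : WeightedProtocol X Y Z R S (k + 1) .alice) (x : X) (r : R) :
    G.act.msgAlice (x, r) [] ∈ G.firstMessages :=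
  Finset.mem_image_of_mem _ (Finset.mem_univ _)

/-- The total weight of Alice's coins on input `x`. -/
def massAlice [Fintype R] (G : WeightedProtocol X Y Z R S k first) (x : X) : ℝ :=
  ∑ r, G.coinAlice x r

/-- The total weight of Bob's coins on input `y`. -/
def massBob [Fintype S] (G : WeightedProtocol X Y Z R S k first) (y : Y) : ℝ :=
  ∑ s, G.coinBob y s

theorem massAlice_nonneg [Fintype R] (G : WeightedProtocol X Y Z R S k first) (x : X) :
    0 ≤ G.massAlice x :=
  Finset.sum_nonneg fun r _ => G.coinAlice_nonneg x r

theorem sum_massAlice_afterMessage [Fintype X] [Fintype R]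
    (G : WeightedProtocol X Y Z R S (k + 1) .alice) (x : X) :
    ∑ m ∈ G.firstMessages, (G.afterMessage m).massAlice x = G.massAlice x := by
  simp only [massAlice, afterMessage]
  rw [Finset.sum_comm]
  refine Finset.sum_congr rfl fun r _ => ?_
  rw [Finset.sum_ite_eq, if_pos (G.msgAlice_mem_firstMessages x r)]

theorem massBob_nonneg [Fintype S] (G : WeightedProtocol X Y Z R S k first) (y : Y) :
    0 ≤ G.massBob y :=
  Finset.sum_nonneg fun s _ => G.coinBob_nonneg y s

variable [Fintype R] [Fintype S]

/-- The total weight of the coins on inputs `x`, `y`. -/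
def mass (G : WeightedProtocol X Y Z R S k first) (x : X) (y : Y) : ℝ :=
  G.massAlice x * G.massBob y

open Classical in
/-- The weight of the coins that lead to the transcript `t` on inputs `x`, `y`. -/
noncomputable def likelihood (G : WeightedProtocol X Y Z R S k first) (x : X) (y : Y)
    (t : History) : ℝ :=
  ∑ r, ∑ s, if G.transcript x y r s = t then G.weight x y r s else 0

/-- The price allowed for the transcript `t` on inputs `x`, `y`: up to constants, the length of an
ideal code for the correction of the prediction `Q`. -/
noncomputable def codeCost (G : WeightedProtocol X Y Z R S k first) (Q : History → ℝ)
    (x : X) (y : Y) (t : History) : ℝ :=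
  2 * Real.logb 2 (G.likelihood x y t / G.mass x y / (Q t / Q [])) + 10 * k

/-- The total weight of the failures on inputs `x`, `y`, plus `lam` times the weighted sum of the
code costs: the loss that would result if each transcript could be sent at its code cost. -/
noncomputable def idealLoss (G : WeightedProtocol X Y Z R S k first) (A : Set Answerer)
    (f : X → Y → Z) (lam : ℝ) (Q : History → ℝ) (x : X) (y : Y) : ℝ :=
  ∑ r, ∑ s, G.weight x y r s * (G.act.failure A (fun x y => f x.1 y.1) (x, r) (y, s)
    + lam * G.codeCost Q x y (G.transcript x y r s))

theorem mass_nonneg (G : WeightedProtocol X Y Z R S k first) (x : X) (y : Y) : 0 ≤ G.mass x y :=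
  mul_nonneg (G.massAlice_nonneg x) (G.massBob_nonneg y)

theorem sum_weight (G : WeightedProtocol X Y Z R S k first) (x : X) (y : Y) :
    ∑ r, ∑ s, G.weight x y r s = G.mass x y :=
  (Finset.sum_mul_sum ..).symm

theorem weight_eq_zero_of_mass_eq_zero {G : WeightedProtocol X Y Z R S k first} {x : X} {y : Y}
    (h : G.mass x y = 0) (r : R) (s : S) : G.weight x y r s = 0 := by
  rw [← sum_weight, Finset.sum_eq_zero_iff_of_nonneg
    fun r _ => Finset.sum_nonneg fun s _ => G.weight_nonneg x y r s] at h
  exact (Finset.sum_eq_zero_iff_of_nonneg fun s _ => G.weight_nonneg x y r s).1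
    (h r (Finset.mem_univ r)) s (Finset.mem_univ s)

theorem mass_pos_of_weight_pos {G : WeightedProtocol X Y Z R S k first} {x : X} {y : Y} {r : R}
    {s : S} (h : 0 < G.weight x y r s) : 0 < G.mass x y :=
  (G.mass_nonneg x y).lt_of_ne' fun h0 => h.ne' (weight_eq_zero_of_mass_eq_zero h0 r s)

theorem idealLoss_eq_zero_of_mass_eq_zero {G : WeightedProtocol X Y Z R S k first} {x : X} {y : Y}
    (h : G.mass x y = 0) (A : Set Answerer) (f : X → Y → Z) (lam : ℝ) (Q : History → ℝ) :
    G.idealLoss A f lam Q x y = 0 :=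
  Finset.sum_eq_zero fun r _ => Finset.sum_eq_zero fun s _ => by
    rw [weight_eq_zero_of_mass_eq_zero h, zero_mul]

theorem mass_swap (G : WeightedProtocol X Y Z R S k first) (x : X) (y : Y) :
    G.swap.mass y x = G.mass x y :=
  mul_comm _ _

theorem likelihood_swap (G : WeightedProtocol X Y Z R S k first) (x : X) (y : Y) (t : History) :
    G.swap.likelihood y x t = G.likelihood x y t := by
  simp only [likelihood, transcript_swap, weight_swap]
  exact Finset.sum_comm

theorem idealLoss_swap (G : WeightedProtocol X Y Z R S k first) (A : Set Answerer)
    (f : X → Y → Z) (lam : ℝ) (Q : History → ℝ) (x : X) (y : Y) :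
    G.swap.idealLoss (Answerer.swap ⁻¹' A) (fun y x => f x y) lam Q y x
      = G.idealLoss A f lam Q x y := by
  simp only [idealLoss, codeCost, transcript_swap, weight_swap, likelihood_swap, mass_swap]
  rw [Finset.sum_comm]
  simp only [← G.act.failure_swap A fun x y => f x.1 y.1]
  rfl

theorem likelihood_cons (G : WeightedProtocol X Y Z R S (k + 1) .alice) (x : X) (y : Y)
    (m : Message) (t : History) :
    G.likelihood x y (m :: t) = (G.afterMessage m).likelihood x y t := by
  unfold likelihood
  refine Finset.sum_congr rfl fun r _ => Finset.sum_congr rfl fun s _ => ?_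
  rw [transcript_eq_cons, weight_afterMessage]
  by_cases hm : G.act.msgAlice (x, r) [] = m
  · simp only [hm, List.cons.injEq, true_and, if_true]
  · simp only [hm, List.cons.injEq, false_and, if_false, ite_self]

theorem likelihood_transcript_pos {G : WeightedProtocol X Y Z R S k first} {x : X} {y : Y} {r : R}
    {s : S} (h : 0 < G.weight x y r s) : 0 < G.likelihood x y (G.transcript x y r s) := by
  have hterm : ∀ r' s', 0 ≤ (if G.transcript x y r' s' = G.transcript x y r s
      then G.weight x y r' s' else 0) := fun r' s' =>
    ite_nonneg (G.weight_nonneg x y r' s') le_rfl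
  refine Finset.sum_pos' (fun r' _ => Finset.sum_nonneg fun s' _ => hterm r' s')
    ⟨r, Finset.mem_univ r, Finset.sum_pos' (fun s' _ => hterm r s') ⟨s, Finset.mem_univ s, ?_⟩⟩
  rwa [if_pos rfl]

theorem massAlice_pos_of_mass_pos {G : WeightedProtocol X Y Z R S k first} {x : X} {y : Y}
    (h : 0 < G.mass x y) : 0 < G.massAlice x :=
  pos_of_mul_pos_left h (G.massBob_nonneg y)

theorem DominatedBy.nil_pos {G : WeightedProtocol X Y Z R S k first} {Q : History → ℝ} {x : X}
    {y : Y} (h : G.DominatedBy Q x y) (hQ : IsSemimeasure Q) (hmass : 0 < G.mass x y) :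
    0 < Q [] := by
  by_contra hnil
  refine hmass.ne' ?_
  rw [← sum_weight]
  refine Finset.sum_eq_zero fun r _ => Finset.sum_eq_zero fun s _ => ?_
  by_contra hrs
  exact hnil ((h r s ((G.weight_nonneg x y r s).lt_of_ne' hrs)).trans_le (hQ.append_le [] _))

theorem codeCost_eq_add_afterMessage {G : WeightedProtocol X Y Z R S (k + 1) .alice}
    {Q : History → ℝ} (hQ : IsSemimeasure Q) {x : X} {y : Y} (hG : G.DominatedBy Q x y) {r : R}
    {s : S} (h : 0 < G.weight x y r s) {m : Message} (hm : G.act.msgAlice (x, r) [] = m) :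
    G.codeCost Q x y (G.transcript x y r s)
      = 2 * Real.logb 2 ((G.afterMessage m).massAlice x / G.massAlice x / (Q [m] / Q [])) + 10
        + (G.afterMessage m).codeCost (fun t => Q (m :: t)) x y
            ((G.afterMessage m).transcript x y r s) := by
  have h' : 0 < (G.afterMessage m).weight x y r s := by rwa [weight_afterMessage, if_pos hm]
  have hmass := mass_pos_of_weight_pos h
  have hmass' := mass_pos_of_weight_pos h'
  have hA := massAlice_pos_of_mass_pos hmass
  have hA' := massAlice_pos_of_mass_pos hmass'
  have hB : 0 < G.massBob y := pos_of_mul_pos_right hmass (G.massAlice_nonneg x)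
  have hl := likelihood_transcript_pos h'
  have hQt := hG.afterMessage m r s h'
  have hQm : 0 < Q [m] := (hG.afterMessage m).nil_pos (hQ.cons m) hmass'
  have hQ0 : 0 < Q [] := hG.nil_pos hQ hmass
  have hmassBob : (G.afterMessage m).massBob y = G.massBob y := rfl
  rw [transcript_eq_cons, hm]
  simp only [codeCost, likelihood_cons, mass, hmassBob]
  set t := (G.afterMessage m).transcript x y r s
  set l := (G.afterMessage m).likelihood x y t
  have hfactor : l / (G.massAlice x * G.massBob y) / (Q (m :: t) / Q [])
      = (G.afterMessage m).massAlice x / G.massAlice x / (Q [m] / Q [])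
        * (l / ((G.afterMessage m).massAlice x * G.massBob y) / (Q (m :: t) / Q [m])) := by
    field_simp
  rw [hfactor, Real.logb_mul (by positivity) (by positivity)]
  push_cast
  ring

theorem idealLoss_eq_sum_afterMessage [Fintype X]
    {G : WeightedProtocol X Y Z R S (k + 1) .alice} {Q : History → ℝ} (hQ : IsSemimeasure Q)
    {x : X} {y : Y} (hG : G.DominatedBy Q x y) (A : Set Answerer) (f : X → Y → Z) (lam : ℝ) :
    G.idealLoss A f lam Q x y = ∑ m ∈ G.firstMessages, ((G.afterMessage m).mass x y * (lam *
        (2 * Real.logb 2 ((G.afterMessage m).massAlice x / G.massAlice x / (Q [m] / Q [])) + 10))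
      + (G.afterMessage m).idealLoss A f lam (fun t => Q (m :: t)) x y) := by
  simp only [← sum_weight, idealLoss, Finset.sum_mul, ← Finset.sum_add_distrib, ← mul_add]
  simp only [weight_afterMessage, ite_mul, zero_mul]
  symm
  rw [Finset.sum_comm]
  refine Finset.sum_congr rfl fun r _ => ?_
  rw [Finset.sum_comm]
  refine Finset.sum_congr rfl fun s _ => ?_
  rw [Finset.sum_ite_eq, if_pos (G.msgAlice_mem_firstMessages x r)]
  rcases (G.weight_nonneg x y r s).eq_or_lt with h | h
  · rw [← h, zero_mul, zero_mul]
  · have hfailure : G.act.failure A (fun x y => f x.1 y.1) (x, r) (y, s)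
        = (G.afterMessage (G.act.msgAlice (x, r) [])).act.failure A (fun x y => f x.1 y.1)
            (x, r) (y, s) :=
      G.act.failure_eq_tail A _ (x, r) (y, s)
    rw [hfailure, codeCost_eq_add_afterMessage hQ hG h rfl]
    ring

theorem idealLoss_zero (G : WeightedProtocol X Y Z R S 0 first)
    (A : Set Answerer) (f : X → Y → Z) (lam : ℝ) (Q : History → ℝ) (x : X) (y : Y) :
    G.idealLoss A f lam Q x y
      = ∑ r, ∑ s, G.weight x y r s * G.act.failure A (fun x y => f x.1 y.1) (x, r) (y, s) := by
  have htranscript : ∀ r s, G.transcript x y r s = [] := fun _ _ => rfl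
  have hlikelihood : G.likelihood x y [] = G.mass x y := by
    simp only [likelihood, htranscript, if_true, sum_weight]
  have hcost : G.codeCost Q x y [] = 0 := by
    rw [codeCost, hlikelihood]
    rcases eq_or_ne (G.mass x y) 0 with hmass | hmass <;> rcases eq_or_ne (Q []) 0 with hQ | hQ <;>
      simp [hmass, hQ]
  simp only [idealLoss, htranscript, hcost, mul_zero, add_zero]

theorem sum_mass_afterMessage [Fintype X] (G : WeightedProtocol X Y Z R S (k + 1) .alice) (x : X)
    (y : Y) : ∑ m ∈ G.firstMessages, (G.afterMessage m).mass x y = G.mass x y := by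
  rw [mass, ← sum_massAlice_afterMessage, Finset.sum_mul]
  rfl

variable [Fintype Y]

theorem sum_mul_mass (G : WeightedProtocol X Y Z R S k first) (w : Y → ℝ) (x : X) :
    ∑ y, w y * G.mass x y = G.massAlice x * ∑ y, w y * G.massBob y := by
  simp only [Finset.mul_sum, mass, mul_left_comm]

theorem sum_mul_mass_afterMessage_div {G : WeightedProtocol X Y Z R S (k + 1) .alice}
    {w : Y → ℝ} {x : X} {m : Message} (h : ∑ y, w y * (G.afterMessage m).mass x y ≠ 0) :
    (∑ y, w y * (G.afterMessage m).mass x y) / ∑ y, w y * G.mass x y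
      = (G.afterMessage m).massAlice x / G.massAlice x := by
  rw [sum_mul_mass] at h ⊢
  rw [sum_mul_mass]
  exact mul_div_mul_right _ _ (right_ne_zero_of_mul h)

theorem sum_sum_mul_mass_afterMessage [Fintype X] (G : WeightedProtocol X Y Z R S (k + 1) .alice)
    (w : Y → ℝ) (x : X) :
    ∑ m ∈ G.firstMessages, ∑ y, w y * (G.afterMessage m).mass x y = ∑ y, w y * G.mass x y := by
  rw [Finset.sum_comm]
  simp only [← Finset.mul_sum, sum_mass_afterMessage]

theorem mul_mass_eq_zero {G : WeightedProtocol X Y Z R S k first} {w : Y → ℝ} (hw : ∀ y, 0 ≤ w y)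
    {x : X} (h : ∑ y, w y * G.mass x y = 0) (y : Y) : w y * G.mass x y = 0 :=
  (Finset.sum_eq_zero_iff_of_nonneg fun y _ => mul_nonneg (hw y) (G.mass_nonneg x y)).1 h y
    (Finset.mem_univ y)

theorem sum_mul_idealLoss_eq_zero {G : WeightedProtocol X Y Z R S k first} {w : Y → ℝ}
    (hw : ∀ y, 0 ≤ w y) {x : X} (h : ∑ y, w y * G.mass x y = 0) (A : Set Answerer)
    (f : X → Y → Z) (lam : ℝ) (Q : History → ℝ) :
    ∑ y, w y * G.idealLoss A f lam Q x y = 0 := by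
  refine Finset.sum_eq_zero fun y _ => ?_
  rcases mul_eq_zero.1 (mul_mass_eq_zero hw h y) with hy | hy
  · rw [hy, zero_mul]
  · rw [idealLoss_eq_zero_of_mass_eq_zero hy, mul_zero]

theorem DominatedBy.singleton_pos {G : WeightedProtocol X Y Z R S (k + 1) .alice} {Q : History → ℝ}
    (hQ : IsSemimeasure Q) {w : Y → ℝ} (hw : ∀ y, 0 ≤ w y) {x : X}
    (hG : ∀ y, 0 < w y → G.DominatedBy Q x y) {m : Message}
    (h : 0 < ∑ y, w y * (G.afterMessage m).mass x y) : 0 < Q [m] := by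
  obtain ⟨y, -, hy⟩ := Finset.exists_lt_of_sum_lt (s := Finset.univ) (f := fun _ : Y => (0 : ℝ))
    (by simpa using h)
  exact ((hG y (pos_of_mul_pos_left hy (mass_nonneg _ x y))).afterMessage m).nil_pos (hQ.cons m)
    (pos_of_mul_pos_right hy (hw y))

theorem sum_mul_idealLoss_eq_sum_afterMessage [Fintype X]
    {G : WeightedProtocol X Y Z R S (k + 1) .alice} {Q : History → ℝ} (hQ : IsSemimeasure Q)
    {w : Y → ℝ} (hw : ∀ y, 0 ≤ w y) {x : X} (hG : ∀ y, 0 < w y → G.DominatedBy Q x y)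
    (A : Set Answerer) (f : X → Y → Z) (lam : ℝ) :
    ∑ y, w y * G.idealLoss A f lam Q x y = ∑ m ∈ G.firstMessages,
      ((∑ y, w y * (G.afterMessage m).mass x y) * (lam *
          (2 * Real.logb 2 ((G.afterMessage m).massAlice x / G.massAlice x / (Q [m] / Q [])) + 10))
        + ∑ y, w y * (G.afterMessage m).idealLoss A f lam (fun t => Q (m :: t)) x y) := by
  simp only [Finset.sum_mul, ← Finset.sum_add_distrib]
  rw [Finset.sum_comm]
  refine Finset.sum_congr rfl fun y _ => ?_
  rcases (hw y).eq_or_lt with hy | hy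
  · simp only [← hy, zero_mul, add_zero, Finset.sum_const_zero]
  · simp only [idealLoss_eq_sum_afterMessage hQ (hG y hy), Finset.mul_sum, mul_add, mul_assoc]

theorem exists_code_firstMessages [Fintype X] [Nonempty X] [Nonempty R]
    (G : WeightedProtocol X Y Z R S (k + 1) .alice) (A : Set Answerer) (f : X → Y → Z) {lam : ℝ}
    (hlam : 0 ≤ lam) {w : X → Y → ℝ} (hw : ∀ x y, 0 ≤ w x y) {Q : History → ℝ}
    (hQ : IsSemimeasure Q) (hG : ∀ x y, 0 < w x y → G.DominatedBy Q x y) :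
    ∃ (enc : X → Message) (dec : Message → Message),
      (∀ x x', enc x <+: enc x' → enc x = enc x') ∧
      (∀ x, 0 < ∑ y, w x y * G.mass x y →
        0 < ∑ y, w x y * (G.afterMessage (dec (enc x))).mass x y) ∧
      ∑ x, (∑ y, w x y * G.mass x y) * (lam * (enc x).length
          + (∑ y, w x y * (G.afterMessage (dec (enc x))).idealLoss A f lam
              (fun t => Q (dec (enc x) :: t)) x y)
            / ∑ y, w x y * (G.afterMessage (dec (enc x))).mass x y)
        ≤ ∑ x, ∑ y, w x y * G.idealLoss A f lam Q x y := by
  have hM : Nonempty G.firstMessages :=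
    ⟨⟨_, G.msgAlice_mem_firstMessages (Classical.arbitrary X) (Classical.arbitrary R)⟩⟩
  let v : X → G.firstMessages → ℝ := fun x m => ∑ y, w x y * (G.afterMessage m).mass x y
  have hv : ∀ x m, 0 ≤ v x m := fun x m =>
    Finset.sum_nonneg fun y _ => mul_nonneg (hw x y) (mass_nonneg _ x y)
  have hsum : ∀ x, ∑ m, v x m = ∑ y, w x y * G.mass x y := fun x =>
    (Finset.sum_coe_sort G.firstMessages _).trans (G.sum_sum_mul_mass_afterMessage (w x) x)
  have hq1 : ∑ m : G.firstMessages, Q [(m : Message)] / Q [] ≤ 1 := by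
    rw [← Finset.sum_div, Finset.sum_coe_sort G.firstMessages fun m => Q [m]]
    exact div_le_one_of_le₀ (hQ.sum_append_le [] G.firstMessages) (hQ.nonneg [])
  have hvq : ∀ x (m : G.firstMessages), 0 < v x m → 0 < Q [(m : Message)] / Q [] := fun x m h =>
    have hQm : 0 < Q [(m : Message)] := DominatedBy.singleton_pos hQ (hw x) (hG x) h
    div_pos hQm (hQm.trans_le (hQ.append_le [] [(m : Message)]))
  obtain ⟨enc, dec, henc, hpos, hle⟩ := exists_code_of_weights
    (fun m : G.firstMessages => div_nonneg (hQ.nonneg [(m : Message)]) (hQ.nonneg [])) hq1 hv hvq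
    (fun x m h => sum_mul_idealLoss_eq_zero (hw x) h A f lam fun t => Q ((m : Message) :: t)) hlam
  simp only [hsum] at hpos hle
  refine ⟨enc, fun c => dec c, henc, hpos, hle.trans_eq (Finset.sum_congr rfl fun x _ => ?_)⟩
  rw [sum_mul_idealLoss_eq_sum_afterMessage hQ (hw x) (hG x)]
  refine Eq.trans (Finset.sum_congr rfl fun m _ => ?_) (Finset.sum_coe_sort G.firstMessages _)
  rcases eq_or_ne (v x m) 0 with h0 | h0
  · simp only [v] at h0
    simp only [v, h0, zero_mul]
  · rw [sum_mul_mass_afterMessage_div h0]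

theorem mul_div_massAlice_mul_mass (G : WeightedProtocol X Y Z R S (k + 1) .alice) {w : Y → ℝ}
    (hw : ∀ y, 0 ≤ w y) {x : X} {m : Message} (hm : 0 < ∑ y, w y * G.mass x y →
      0 < ∑ y, w y * (G.afterMessage m).mass x y) (y : Y) :
    w y * (G.massAlice x / (G.afterMessage m).massAlice x) * (G.afterMessage m).mass x y
      = w y * G.mass x y := by
  have hmass : (G.afterMessage m).mass x y = (G.afterMessage m).massAlice x * G.massBob y := rfl
  rw [hmass]
  rcases eq_or_ne (∑ y, w y * G.mass x y) 0 with h0 | h0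
  · have hy : w y * (G.massAlice x * G.massBob y) = 0 := mul_mass_eq_zero hw h0 y
    rw [mass, hy]
    linear_combination (G.afterMessage m).massAlice x / (G.afterMessage m).massAlice x * hy
  · have hpos := hm ((Finset.sum_nonneg fun y _ =>
      mul_nonneg (hw y) (G.mass_nonneg x y)).lt_of_ne' h0)
    rw [sum_mul_mass] at hpos
    have hne := left_ne_zero_of_mul hpos.ne'
    rw [mass]
    field_simp

theorem sum_add_mul_div_massAlice (G : WeightedProtocol X Y Z R S (k + 1) .alice) {w : Y → ℝ}
    (hw : ∀ y, 0 ≤ w y) (x : X) (m : Message) (c : ℝ) (A : Set Answerer) (f : X → Y → Z)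
    (lam : ℝ) (Q : History → ℝ) :
    ∑ y, (w y * (G.mass x y * c) + w y * (G.massAlice x / (G.afterMessage m).massAlice x)
        * (G.afterMessage m).idealLoss A f lam Q x y)
      = (∑ y, w y * G.mass x y) * (c + (∑ y, w y * (G.afterMessage m).idealLoss A f lam Q x y)
          / ∑ y, w y * (G.afterMessage m).mass x y) := by
  have hloss : ∑ y, w y * (G.massAlice x / (G.afterMessage m).massAlice x)
        * (G.afterMessage m).idealLoss A f lam Q x y
      = G.massAlice x / (G.afterMessage m).massAlice x
        * ∑ y, w y * (G.afterMessage m).idealLoss A f lam Q x y := by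
    rw [Finset.mul_sum]
    exact Finset.sum_congr rfl fun y _ => by ring
  have hmass : ∑ y, w y * (G.afterMessage m).mass x y
      = (G.afterMessage m).massAlice x * ∑ y, w y * G.massBob y := sum_mul_mass _ w x
  rw [Finset.sum_add_distrib, hloss, mul_add, Finset.sum_mul]
  simp only [mul_assoc, add_right_inj]
  rcases eq_or_ne (∑ y, w y * G.massBob y) 0 with h0 | h0
  · rw [sum_mul_idealLoss_eq_zero hw (hmass.trans (by rw [h0, mul_zero])), zero_div, mul_zero,
      mul_zero]
  · rw [hmass, sum_mul_mass, ← mul_div_assoc, ← mul_div_mul_right _ _ h0]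
    ring

/-- The weights `w'` compensate for conditioning on the message `dec (enc x)`, which replaces the
first message of Alice. -/
theorem exists_code_change_of_weights [Fintype X] [Nonempty X] [Nonempty R]
    (G : WeightedProtocol X Y Z R S (k + 1) .alice) (A : Set Answerer) (f : X → Y → Z) {lam : ℝ}
    (hlam : 0 ≤ lam) {w : X → Y → ℝ} (hw : ∀ x y, 0 ≤ w x y) {Q : History → ℝ}
    (hQ : IsSemimeasure Q) (hG : ∀ x y, 0 < w x y → G.DominatedBy Q x y) :
    ∃ (enc : X → Message) (dec : Message → Message) (w' : X → Y → ℝ),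
      (∀ x x', enc x <+: enc x' → enc x = enc x') ∧ (∀ x y, 0 ≤ w' x y) ∧
      (∀ x y, 0 < w' x y → 0 < w x y) ∧
      (∀ x y, w' x y * (G.afterMessage (dec (enc x))).mass x y = w x y * G.mass x y) ∧
      ∑ x, ∑ y, (w x y * (G.mass x y * (lam * (enc x).length))
          + w' x y * (G.afterMessage (dec (enc x))).idealLoss A f lam
              (fun t => Q (dec (enc x) :: t)) x y)
        ≤ ∑ x, ∑ y, w x y * G.idealLoss A f lam Q x y := by
  obtain ⟨enc, dec, henc, hpos, hle⟩ := G.exists_code_firstMessages A f hlam hw hQ hG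
  have hratio : ∀ x, 0 ≤ G.massAlice x / (G.afterMessage (dec (enc x))).massAlice x := fun x =>
    div_nonneg (G.massAlice_nonneg x) (massAlice_nonneg _ x)
  refine ⟨enc, dec, fun x y => w x y * (G.massAlice x / (G.afterMessage (dec (enc x))).massAlice x),
    henc, fun x y => mul_nonneg (hw x y) (hratio x), fun x y h => pos_of_mul_pos_left h (hratio x),
    fun x => G.mul_div_massAlice_mul_mass (hw x) (hpos x), hle.trans' (le_of_eq ?_)⟩
  exact Finset.sum_congr rfl fun x _ => G.sum_add_mul_div_massAlice (hw x) x _ _ A f lam _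

end WeightedProtocol

open WeightedProtocol

/-- Every weighted protocol with `k` rounds can be replaced by a prefix-free deterministic one,
whose average loss is at most the average ideal loss of the given one. -/
def Compressible (X Y Z R S : Type*) [Fintype X] [Fintype Y] [Fintype R] [Fintype S]
    (k : ℕ) (first : Party) : Prop :=
  ∀ (G : WeightedProtocol X Y Z R S k first) (A : Set Answerer) (f : X → Y → Z) (lam : ℝ)
    (w : X → Y → ℝ) (Q : History → ℝ), 0 ≤ lam → (∀ x y, 0 ≤ w x y) → IsSemimeasure Q →
    (∀ x y, 0 < w x y → G.DominatedBy Q x y) →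
    ∃ P : Protocol X Y Z k first, P.PrefixFree ∧
      ∑ x, ∑ y, w x y * (G.mass x y * P.loss A f lam x y)
        ≤ ∑ x, ∑ y, w x y * G.idealLoss A f lam Q x y

section Compression

variable {X Y Z R S : Type*} [Fintype X] [Fintype Y] [Fintype R] [Fintype S] {k : ℕ}
  {first : Party}

theorem Compressible.swap (h : Compressible Y X Z S R k first.other) :
    Compressible X Y Z R S k first := by
  intro G A f lam w Q hlam hw hQ hG
  obtain ⟨P, hP, hle⟩ := h G.swap (Answerer.swap ⁻¹' A) (fun y x => f x y) lam (fun y x => w x y) Q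
    hlam (fun y x => hw x y) hQ fun y x hwxy => (hG x y hwxy).swap
  obtain ⟨P', rfl⟩ : ∃ P' : Protocol X Y Z k first, P'.swap = P :=
    ⟨⟨P.msgBob, P.msgAlice, P.outBob, P.outAlice, P.outTranscript⟩, rfl⟩
  refine ⟨P', ⟨hP.2, hP.1⟩, ?_⟩
  simp only [mass_swap, Protocol.loss_swap, idealLoss_swap] at hle
  rwa [Finset.sum_comm, Finset.sum_comm (f := fun x y => w x y * G.idealLoss A f lam Q x y)]

theorem WeightedProtocol.exists_coins_le [Nonempty R] [Nonempty S]
    (G : WeightedProtocol X Y Z R S k first) (w : X → Y → ℝ) (c : X → R → Y → S → ℝ) :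
    ∃ (ρ : X → R) (σ : Y → S), ∑ x, ∑ y, w x y * (G.mass x y * c x (ρ x) y (σ y))
      ≤ ∑ x, ∑ y, w x y * ∑ r, ∑ s, G.weight x y r s * c x r y s := by
  obtain ⟨ρ, hρ⟩ := exists_forall_sum_mul_le G.coinAlice_nonneg
    fun x r => ∑ y, ∑ s, G.coinBob y s * (w x y * c x r y s)
  obtain ⟨σ, hσ⟩ := exists_forall_sum_mul_le G.coinBob_nonneg
    fun y s => ∑ x, G.massAlice x * (w x y * c x (ρ x) y s)
  refine ⟨ρ, σ, ?_⟩
  calc ∑ x, ∑ y, w x y * (G.mass x y * c x (ρ x) y (σ y))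
      = ∑ y, G.massBob y * ∑ x, G.massAlice x * (w x y * c x (ρ x) y (σ y)) := by
        rw [Finset.sum_comm]
        simp only [Finset.mul_sum, mass]
        exact Finset.sum_congr rfl fun y _ => Finset.sum_congr rfl fun x _ => by ring
    _ ≤ ∑ y, ∑ s, G.coinBob y s * ∑ x, G.massAlice x * (w x y * c x (ρ x) y s) := hσ
    _ = ∑ x, G.massAlice x * ∑ y, ∑ s, G.coinBob y s * (w x y * c x (ρ x) y s) := by
        simp only [Finset.mul_sum, mul_left_comm (G.coinBob _ _)]
        rw [Finset.sum_congr rfl fun y _ => Finset.sum_comm, Finset.sum_comm]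
    _ ≤ ∑ x, ∑ r, G.coinAlice x r * ∑ y, ∑ s, G.coinBob y s * (w x y * c x r y s) := hρ
    _ = ∑ x, ∑ y, w x y * ∑ r, ∑ s, G.weight x y r s * c x r y s := by
        refine Finset.sum_congr rfl fun x _ => ?_
        simp only [Finset.mul_sum, weight]
        rw [Finset.sum_comm]
        exact Finset.sum_congr rfl fun y _ => Finset.sum_congr rfl fun r _ =>
          Finset.sum_congr rfl fun s _ => by ring

theorem compressible_zero [Nonempty R] [Nonempty S] : Compressible X Y Z R S 0 first := by
  intro G A f lam w Q _ _ _ _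
  obtain ⟨ρ, σ, hle⟩ := G.exists_coins_le w
    fun x r y s => G.act.failure A (fun x y => f x.1 y.1) (x, r) (y, s)
  let P : Protocol X Y Z 0 first :=
    ⟨fun _ _ => [], fun _ _ => [], fun x => G.act.outAlice (x, ρ x),
      fun y => G.act.outBob (y, σ y), G.act.outTranscript⟩
  have hloss : ∀ x y, P.loss A f lam x y
      = G.act.failure A (fun x y => f x.1 y.1) (x, ρ x) (y, σ y) := by
    intro x y
    have hbits : P.bits x y = 0 := rfl
    rw [Protocol.loss, hbits, Nat.cast_zero, mul_zero, add_zero]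
    exact Protocol.failure_congr (forall₂_congr fun o _ => by cases o <;> rfl)
  refine ⟨P, ⟨fun _ _ _ _ => rfl, fun _ _ _ _ => rfl⟩, ?_⟩
  simpa only [hloss, idealLoss_zero] using hle

theorem Compressible.exists_family {ι : Type*} (h : Compressible X Y Z R S k first)
    (label : X → ι) (G : ι → WeightedProtocol X Y Z R S k first) (A : Set Answerer)
    (f : X → Y → Z) {lam : ℝ} (hlam : 0 ≤ lam) {w : X → Y → ℝ} (hw : ∀ x y, 0 ≤ w x y)
    {Q : ι → History → ℝ} (hQ : ∀ i, IsSemimeasure (Q i))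
    (hG : ∀ x y, 0 < w x y → (G (label x)).DominatedBy (Q (label x)) x y) :
    ∃ P : ι → Protocol X Y Z k first, (∀ i, (P i).PrefixFree) ∧
      ∑ x, ∑ y, w x y * ((G (label x)).mass x y * (P (label x)).loss A f lam x y)
        ≤ ∑ x, ∑ y, w x y * (G (label x)).idealLoss A f lam (Q (label x)) x y := by
  classical
  have hi : ∀ i, ∃ P : Protocol X Y Z k first, P.PrefixFree ∧
      ∑ x, ∑ y, (if label x = i then w x y else 0) * ((G i).mass x y * P.loss A f lam x y)
        ≤ ∑ x, ∑ y, (if label x = i then w x y else 0) * (G i).idealLoss A f lam (Q i) x y := by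
    refine fun i => h (G i) A f lam _ (Q i) hlam (fun x y => ite_nonneg (hw x y) le_rfl) (hQ i) ?_
    intro x y hxy
    split_ifs at hxy with hlabel
    · exact hlabel ▸ hG x y hxy
    · exact absurd hxy (lt_irrefl 0)
  choose P hP hle using hi
  have hsum : ∀ c : ι → X → Y → ℝ, ∑ i ∈ Finset.univ.image label, ∑ x, ∑ y,
      (if label x = i then w x y else 0) * c i x y = ∑ x, ∑ y, w x y * c (label x) x y := by
    intro c
    rw [Finset.sum_comm]
    refine Finset.sum_congr rfl fun x _ => ?_
    simp only [ite_mul, zero_mul]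
    rw [Finset.sum_comm]
    refine Finset.sum_congr rfl fun y _ => ?_
    rw [Finset.sum_ite_eq, if_pos (Finset.mem_image_of_mem label (Finset.mem_univ x))]
  refine ⟨P, hP, ?_⟩
  rw [← hsum fun i x y => (G i).mass x y * (P i).loss A f lam x y,
    ← hsum fun i => (G i).idealLoss A f lam (Q i)]
  exact Finset.sum_le_sum fun i _ => hle i

theorem Compressible.alice_succ [Nonempty X] [Nonempty R] (h : Compressible X Y Z R S k .bob) :
    Compressible X Y Z R S (k + 1) .alice := by
  intro G A f lam w Q hlam hw hQ hG
  obtain ⟨enc, dec, w', henc, hw', hpos, hmass, hle⟩ :=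
    G.exists_code_change_of_weights A f hlam hw hQ hG
  obtain ⟨P, hP, hPle⟩ := h.exists_family enc (fun c => G.afterMessage (dec c)) A f hlam hw'
    (fun c => hQ.cons (dec c)) fun x y hxy => (hG x y (hpos x y hxy)).afterMessage _
  refine ⟨Protocol.consAlice enc P, Protocol.prefixFree_consAlice henc hP, ?_⟩
  calc ∑ x, ∑ y, w x y * (G.mass x y * (Protocol.consAlice enc P).loss A f lam x y)
      = ∑ x, ∑ y, w x y * (G.mass x y * (lam * (enc x).length)) + ∑ x, ∑ y,
          w' x y * ((G.afterMessage (dec (enc x))).mass x y * (P (enc x)).loss A f lam x y) := by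
        simp only [Protocol.loss_consAlice, mul_add, Finset.sum_add_distrib, ← mul_assoc, hmass]
    _ ≤ ∑ x, ∑ y, w x y * (G.mass x y * (lam * (enc x).length)) + ∑ x, ∑ y,
          w' x y * (G.afterMessage (dec (enc x))).idealLoss A f lam
            (fun t => Q (dec (enc x) :: t)) x y := by gcongr
    _ ≤ ∑ x, ∑ y, w x y * G.idealLoss A f lam Q x y := by
        simpa only [Finset.sum_add_distrib] using hle

theorem compressible [Nonempty X] [Nonempty Y] [Nonempty R] [Nonempty S] (k : ℕ) (first : Party) :
    Compressible X Y Z R S k first := by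
  induction k generalizing first with
  | zero => exact compressible_zero
  | succ k ih =>
    cases first with
    | alice => exact (ih .bob).alice_succ
    | bob =>
      have hswap : Compressible Y X Z S R k .bob := Compressible.swap (first := .bob) (ih .alice)
      exact Compressible.swap (first := .bob) hswap.alice_succ

end Compression

/-! ### Mutual information -/

section Information

variable {Ω S S' : Type*} [Fintype Ω] (p : PMF Ω)

open Classical in
theorem prob_eq_sum_ite (E : Set Ω) : prob p E = ∑ ω, if ω ∈ E then (p ω).toReal else 0 := by
  rw [prob, Finset.sum_filter]

theorem prob_nonneg (E : Set Ω) : 0 ≤ prob p E :=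
  Finset.sum_nonneg fun _ _ => ENNReal.toReal_nonneg

theorem sum_toReal_eq_one : ∑ ω, (p ω).toReal = 1 := by
  rw [← ENNReal.toReal_sum fun ω _ => p.apply_ne_top ω, ← tsum_fintype (L := .unconditional Ω),
    p.tsum_coe, ENNReal.toReal_one]

theorem prob_univ : prob p Set.univ = 1 := by
  classical
  simp only [prob_eq_sum_ite, Set.mem_univ, if_true, sum_toReal_eq_one]

theorem toReal_le_prob {E : Set Ω} {ω : Ω} (h : ω ∈ E) : (p ω).toReal ≤ prob p E := by
  classical
  exact Finset.single_le_sum (f := fun ω => (p ω).toReal) (fun _ _ => ENNReal.toReal_nonneg)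
    (Finset.mem_filter.2 ⟨Finset.mem_univ ω, h⟩)

theorem exists_mem_toReal_pos {E : Set Ω} (h : 0 < prob p E) : ∃ ω ∈ E, 0 < (p ω).toReal := by
  classical
  obtain ⟨ω, hω, hne⟩ := Finset.exists_ne_zero_of_sum_ne_zero h.ne'
  exact ⟨ω, (Finset.mem_filter.1 hω).2, ENNReal.toReal_nonneg.lt_of_ne' hne⟩

theorem prob_le_one (E : Set Ω) : prob p E ≤ 1 := by
  classical
  rw [← sum_toReal_eq_one p, prob]
  exact Finset.sum_le_sum_of_subset_of_nonneg (Finset.filter_subset _ _)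
    fun _ _ _ => ENNReal.toReal_nonneg

theorem sum_prob_mul_eq [DecidableEq S] (V : Ω → S) (F : S → ℝ) :
    ∑ s ∈ Finset.univ.image V, prob p {ω | V ω = s} * F s = ∑ ω, (p ω).toReal * F (V ω) := by
  rw [← Finset.sum_fiberwise_of_maps_to (g := V) (t := Finset.univ.image V)
    (fun ω _ => Finset.mem_image_of_mem V (Finset.mem_univ ω))]
  refine Finset.sum_congr rfl fun s _ => ?_
  rw [prob, Finset.sum_mul]
  simp only [Set.mem_ofPred_eq]
  refine Finset.sum_congr rfl fun ω hω => ?_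
  rw [(Finset.mem_filter.1 hω).2]

theorem sum_prob_eq_one [DecidableEq S] (V : Ω → S) :
    ∑ s ∈ Finset.univ.image V, prob p {ω | V ω = s} = 1 := by
  simpa only [mul_one, sum_toReal_eq_one] using sum_prob_mul_eq p V fun _ => 1

theorem entropy_eq_sum (V : Ω → S) :
    entropy p V = -∑ ω, (p ω).toReal * Real.logb 2 (prob p {ω' | V ω' = V ω}) := by
  classical
  rw [entropy, sum_prob_mul_eq p V fun s => Real.logb 2 (prob p {ω | V ω = s})]

theorem mutualInfo_eq_sum (V : Ω → S) (W : Ω → S') :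
    mutualInfo p V W = ∑ ω, (p ω).toReal * Real.logb 2 (prob p {ω' | (V ω', W ω') = (V ω, W ω)}
      / (prob p {ω' | V ω' = V ω} * prob p {ω' | W ω' = W ω})) := by
  simp only [mutualInfo, entropy_eq_sum]
  rw [sub_neg_eq_add, ← neg_add, neg_add_eq_sub, ← Finset.sum_add_distrib, ← Finset.sum_sub_distrib]
  refine Finset.sum_congr rfl fun ω _ => ?_
  rcases (ENNReal.toReal_nonneg : 0 ≤ (p ω).toReal).eq_or_lt with h | h
  · simp only [← h, zero_mul, add_zero, sub_zero]
  · have hprob : ∀ E : Set Ω, ω ∈ E → prob p E ≠ 0 := fun E hE =>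
      (h.trans_le (toReal_le_prob p hE)).ne'
    have hV := hprob {ω' | V ω' = V ω} rfl
    have hW := hprob {ω' | W ω' = W ω} rfl
    have hVW := hprob {ω' | (V ω', W ω') = (V ω, W ω)} rfl
    rw [Real.logb_div hVW (mul_ne_zero hV hW), Real.logb_mul hV hW]
    ring

theorem sum_mul_logb_div_nonneg {ι : Type*} {s : Finset ι} {p q : ι → ℝ} (hp : ∀ i ∈ s, 0 ≤ p i)
    (hq : ∀ i ∈ s, 0 ≤ q i) (hpq : ∀ i ∈ s, 0 < p i → 0 < q i)
    (hsum : ∑ i ∈ s, q i ≤ ∑ i ∈ s, p i) {b : ℝ} (hb : 1 < b) :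
    0 ≤ ∑ i ∈ s, p i * Real.logb b (p i / q i) := by
  have hlog : ∀ i ∈ s, p i - q i ≤ p i * Real.log (p i / q i) := by
    intro i hi
    rcases (hp i hi).eq_or_lt with h0 | h0
    · rw [← h0, zero_mul, zero_sub]
      exact neg_nonpos.2 (hq i hi)
    · have hle := mul_le_mul_of_nonneg_left
        (Real.one_sub_inv_le_log_of_pos (div_pos h0 (hpq i hi h0))) h0.le
      rwa [inv_div, mul_sub, mul_one, mul_div_cancel₀ _ h0.ne'] at hle
  simp only [Real.logb, ← mul_div_assoc]
  rw [← Finset.sum_div]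
  refine div_nonneg ((sub_nonneg.2 hsum).trans ?_) (Real.log_pos hb).le
  rw [← Finset.sum_sub_distrib]
  exact Finset.sum_le_sum hlog

theorem mutualInfo_nonneg (V : Ω → S) (W : Ω → S') : 0 ≤ mutualInfo p V W := by
  classical
  rw [mutualInfo_eq_sum, ← sum_prob_mul_eq p (fun ω => (V ω, W ω)) fun s =>
    Real.logb 2 (prob p {ω | (V ω, W ω) = s} / (prob p {ω | V ω = s.1} * prob p {ω | W ω = s.2}))]
  refine sum_mul_logb_div_nonneg (fun s _ => prob_nonneg p _)
    (fun s _ => mul_nonneg (prob_nonneg p _) (prob_nonneg p _)) (fun s _ hs => ?_) ?_ one_lt_two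
  · obtain ⟨ω, rfl, hpos⟩ := exists_mem_toReal_pos p hs
    exact mul_pos (hpos.trans_le (toReal_le_prob p rfl)) (hpos.trans_le (toReal_le_prob p rfl))
  · rw [sum_prob_eq_one]
    calc ∑ s ∈ Finset.univ.image fun ω => (V ω, W ω),
          prob p {ω | V ω = s.1} * prob p {ω | W ω = s.2}
        ≤ ∑ s ∈ Finset.univ.image V ×ˢ Finset.univ.image W,
          prob p {ω | V ω = s.1} * prob p {ω | W ω = s.2} := by
          refine Finset.sum_le_sum_of_subset_of_nonneg (fun s hs => ?_)
            fun s _ _ => mul_nonneg (prob_nonneg p _) (prob_nonneg p _)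
          obtain ⟨ω, -, rfl⟩ := Finset.mem_image.1 hs
          simp
      _ = 1 := by
          rw [Finset.sum_product]
          simp only [← Finset.mul_sum, ← Finset.sum_mul, sum_prob_eq_one, one_mul]

end Information

/-! ### Compression of private coin protocols -/

namespace PrivateCoinProtocol

variable {X Y Z R S : Type*} {k : ℕ} {first : Party}

/-- The private coin protocol as a weighted protocol: here the laws of the coins do not depend on
the inputs. -/
noncomputable def toWeighted (P : PrivateCoinProtocol X Y Z R S k first) :
    WeightedProtocol X Y Z R S k first where
  act := P.act
  coinAlice _ r := (P.coinAlice r).toReal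
  coinBob _ s := (P.coinBob s).toReal
  coinAlice_nonneg _ _ := ENNReal.toReal_nonneg
  coinBob_nonneg _ _ := ENNReal.toReal_nonneg

theorem law_apply (P : PrivateCoinProtocol X Y Z R S k first) (μ : PMF (X × Y))
    (z : X × Y) (r : R) (s : S) :
    P.law μ (z, (r, s)) = μ z * (P.coinAlice r * P.coinBob s) := by
  classical
  rw [law, PMF.bind_apply, tsum_eq_single z, PMF.bind_apply, tsum_eq_single r, PMF.map_apply,
    tsum_eq_single s]
  · simp
  · intro s' hs
    simp [hs.symm]
  · intro r' hr
    simp [PMF.map_apply, hr.symm]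
  · intro z' hz
    simp [PMF.bind_apply, PMF.map_apply, hz.symm]

theorem toReal_law (P : PrivateCoinProtocol X Y Z R S k first) (μ : PMF (X × Y))
    (x : X) (y : Y) (r : R) (s : S) :
    (P.law μ ((x, y), (r, s))).toReal = (μ (x, y)).toReal * P.toWeighted.weight x y r s := by
  rw [law_apply, ENNReal.toReal_mul, ENNReal.toReal_mul]
  rfl

variable [Fintype R] [Fintype S]

theorem mass_toWeighted (P : PrivateCoinProtocol X Y Z R S k first) (x : X) (y : Y) :
    P.toWeighted.mass x y = 1 := by
  simp only [mass, massAlice, massBob, toWeighted, sum_toReal_eq_one, mul_one]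

variable [Fintype X] [Fintype Y]

theorem sum_toReal_law_mul (P : PrivateCoinProtocol X Y Z R S k first) (μ : PMF (X × Y))
    (F : (X × Y) × (R × S) → ℝ) :
    ∑ ω, (P.law μ ω).toReal * F ω = ∑ x, ∑ y, (μ (x, y)).toReal
      * ∑ r, ∑ s, P.toWeighted.weight x y r s * F ((x, y), (r, s)) := by
  simp only [Fintype.sum_prod_type, toReal_law, Finset.mul_sum, mul_assoc]

theorem avgError_eq_sum (P : PrivateCoinProtocol X Y Z R S k first) (A : Set Answerer)
    (f : X → Y → Z) (μ : PMF (X × Y)) :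
    P.avgError A f μ = ∑ ω, (P.law μ ω).toReal
      * P.act.failure A (fun x y => f x.1 y.1) (ω.1.1, ω.2.1) (ω.1.2, ω.2.2) := by
  classical
  simp only [avgError, prob_eq_sum_ite, Set.mem_ofPred_eq, Protocol.failure, mul_ite, mul_zero,
    mul_one]
  exact Finset.sum_congr rfl fun ω _ => by split_ifs <;> rfl

theorem prob_input_transcript (P : PrivateCoinProtocol X Y Z R S k first) (μ : PMF (X × Y))
    (x : X) (y : Y) (t : History) :
    prob (P.law μ) {ω | (ω.1, P.randomTranscript ω) = ((x, y), t)}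
      = (μ (x, y)).toReal * P.toWeighted.likelihood x y t := by
  classical
  rw [prob_eq_sum_ite, Fintype.sum_prod_type, Fintype.sum_eq_single (x, y)]
  · rw [Fintype.sum_prod_type, likelihood, Finset.mul_sum]
    refine Finset.sum_congr rfl fun r _ => ?_
    rw [Finset.mul_sum]
    refine Finset.sum_congr rfl fun s _ => ?_
    simp only [Set.mem_ofPred_eq, toReal_law, Prod.mk.injEq, true_and, mul_ite, mul_zero]
    rfl
  · intro z hz
    refine Finset.sum_eq_zero fun c _ => if_neg ?_
    exact fun h => hz (Prod.mk.inj h).1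

theorem prob_input (P : PrivateCoinProtocol X Y Z R S k first) (μ : PMF (X × Y))
    (x : X) (y : Y) : prob (P.law μ) {ω | ω.1 = (x, y)} = (μ (x, y)).toReal := by
  classical
  rw [prob_eq_sum_ite, Fintype.sum_prod_type, Fintype.sum_eq_single (x, y)]
  · simp only [Set.mem_ofPred_eq, if_true, Fintype.sum_prod_type, toReal_law, ← Finset.mul_sum]
    rw [sum_weight, mass_toWeighted, mul_one]
  · exact fun z' hz => Finset.sum_eq_zero fun c _ => if_neg hz

/-- The probability that the transcript starts with `h`. -/
noncomputable def prefixProb (P : PrivateCoinProtocol X Y Z R S k first) (μ : PMF (X × Y))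
    (h : History) : ℝ :=
  prob (P.law μ) {ω | h <+: P.randomTranscript ω}

theorem isSemimeasure_prefixProb (P : PrivateCoinProtocol X Y Z R S k first) (μ : PMF (X × Y)) :
    IsSemimeasure (P.prefixProb μ) := by
  classical
  refine ⟨fun _ => prob_nonneg _ _, fun h F => ?_⟩
  simp only [prefixProb, prob_eq_sum_ite, Set.mem_ofPred_eq]
  rw [Finset.sum_comm]
  refine Finset.sum_le_sum fun ω _ => ?_
  by_cases hex : ∃ m ∈ F, h ++ [m] <+: P.randomTranscript ω
  · obtain ⟨m, hm, hpre⟩ := hex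
    rw [Finset.sum_eq_single_of_mem m hm, if_pos hpre,
      if_pos ((List.prefix_append h [m]).trans hpre)]
    refine fun m' _ hne => if_neg fun hpre' => hne ?_
    have heq : h ++ [m'] = h ++ [m] :=
      (List.prefix_of_prefix_length_le hpre' hpre (by simp)).eq_of_length (by simp)
    simpa using heq
  · push Not at hex
    refine (Finset.sum_eq_zero fun m hm => if_neg (hex m hm)).trans_le ?_
    split_ifs
    exacts [ENNReal.toReal_nonneg, le_rfl]

theorem prefixProb_nil (P : PrivateCoinProtocol X Y Z R S k first) (μ : PMF (X × Y)) :
    P.prefixProb μ [] = 1 := by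
  simpa only [prefixProb, List.nil_prefix, Set.ofPred_true] using prob_univ (P.law μ)

theorem prefixProb_transcript (P : PrivateCoinProtocol X Y Z R S k first) (μ : PMF (X × Y))
    (ω : (X × Y) × (R × S)) : P.prefixProb μ (P.randomTranscript ω)
      = prob (P.law μ) {ω' | P.randomTranscript ω' = P.randomTranscript ω} := by
  have hlength : ∀ ω', (P.randomTranscript ω').length = k := fun _ => P.act.transcript_length _ _
  rw [prefixProb]
  congr 1
  ext ω'
  exact ⟨fun h => (h.eq_of_length ((hlength ω).trans (hlength ω').symm)).symm,
    fun h => (Eq.symm h : P.randomTranscript ω = _) ▸ List.prefix_rfl⟩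

theorem dominatedBy_prefixProb (P : PrivateCoinProtocol X Y Z R S k first) (μ : PMF (X × Y))
    {x : X} {y : Y} (h : 0 < (μ (x, y)).toReal) :
    P.toWeighted.DominatedBy (P.prefixProb μ) x y := fun r s hrs => by
  have hlaw : 0 < (P.law μ ((x, y), (r, s))).toReal := by
    rw [toReal_law]
    exact mul_pos h hrs
  exact hlaw.trans_le (toReal_le_prob _ List.prefix_rfl)

theorem infoCost_eq_sum_codeCost (P : PrivateCoinProtocol X Y Z R S k first) (μ : PMF (X × Y)) :
    2 * P.infoCost μ + 10 * k = ∑ ω, (P.law μ ω).toReal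
      * P.toWeighted.codeCost (P.prefixProb μ) ω.1.1 ω.1.2 (P.randomTranscript ω) := by
  have hconst : ∑ ω, (P.law μ ω).toReal * (10 * k : ℝ) = 10 * k := by
    rw [← Finset.sum_mul, sum_toReal_eq_one, one_mul]
  rw [← hconst, infoCost, mutualInfo_eq_sum, Finset.mul_sum, ← Finset.sum_add_distrib]
  refine Finset.sum_congr rfl fun ω _ => ?_
  rcases (ENNReal.toReal_nonneg : 0 ≤ (P.law μ ω).toReal).eq_or_lt with h | h
  · simp only [← h, zero_mul, mul_zero, add_zero]
  · obtain ⟨⟨x, y⟩, r, s⟩ := ω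
    have hμ : (μ (x, y)).toReal ≠ 0 := fun h0 => h.ne' (by rw [toReal_law, h0, zero_mul])
    rw [prob_input, ← prefixProb_transcript, prob_input_transcript,
      mul_div_mul_left _ _ hμ, codeCost, mass_toWeighted, prefixProb_nil, div_one, div_one]
    ring

theorem sum_mul_idealLoss_toWeighted (P : PrivateCoinProtocol X Y Z R S k first) (A : Set Answerer)
    (f : X → Y → Z) (μ : PMF (X × Y)) (lam : ℝ) :
    ∑ x, ∑ y, (μ (x, y)).toReal * P.toWeighted.idealLoss A f lam (P.prefixProb μ) x y
      = P.avgError A f μ + lam * (2 * P.infoCost μ + 10 * k) := by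
  rw [infoCost_eq_sum_codeCost, avgError_eq_sum, Finset.mul_sum, ← Finset.sum_add_distrib]
  simp only [mul_left_comm lam, ← mul_add]
  rw [sum_toReal_law_mul]
  rfl

theorem exists_sum_mul_loss_le (P : PrivateCoinProtocol X Y Z R S k first) (A : Set Answerer)
    (f : X → Y → Z) (μ : PMF (X × Y)) {lam : ℝ} (hlam : 0 ≤ lam) :
    ∃ P' : Protocol X Y Z k first, P'.PrefixFree ∧
      ∑ z, (μ z).toReal * P'.loss A f lam z.1 z.2
        ≤ P.avgError A f μ + lam * (2 * P.infoCost μ + 10 * k) := by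
  have : Nonempty X := ⟨μ.support_nonempty.some.1⟩
  have : Nonempty Y := ⟨μ.support_nonempty.some.2⟩
  have : Nonempty R := P.coinAlice.support_nonempty.to_type
  have : Nonempty S := P.coinBob.support_nonempty.to_type
  obtain ⟨P', hP', hle⟩ := compressible k first P.toWeighted A f lam
    (fun x y => (μ (x, y)).toReal) (P.prefixProb μ) hlam (fun _ _ => ENNReal.toReal_nonneg)
    (P.isSemimeasure_prefixProb μ) fun _ _ => P.dominatedBy_prefixProb μ
  simp only [mass_toWeighted, one_mul, sum_mul_idealLoss_toWeighted] at hle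
  exact ⟨P', hP', by rwa [Fintype.sum_prod_type]⟩

end PrivateCoinProtocol

section BoundedCost

variable {X Y Z : Type*} [Fintype X] [Fintype Y] {k : ℕ} {first : Party}

theorem Protocol.distError_eq_sum (P : Protocol X Y Z k first) (A : Set Answerer) (f : X → Y → Z)
    (μ : PMF (X × Y)) :
    P.distError A f μ = ∑ z, (μ z).toReal * P.failure A f z.1 z.2 := by
  classical
  simp only [distError, prob_eq_sum_ite, Set.mem_ofPred_eq, failure, mul_ite, mul_zero, mul_one]
  exact Finset.sum_congr rfl fun z _ => by split_ifs <;> rfl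

theorem Protocol.cost_eq_zero (P : Protocol X Y Z 0 first) : P.cost = 0 :=
  Nat.le_zero.1 (Finset.sup_le fun _ _ => le_rfl)

theorem Protocol.cost_truncate_le (P : Protocol X Y Z k first) (B : ℕ) : (P.truncate B).cost ≤ B :=
  Finset.sup_le fun z _ => P.bits_truncate_le B z.1 z.2

theorem exists_prefixFree_cost_eq_zero [Nonempty Z] :
    ∃ P : Protocol X Y Z k first, P.PrefixFree ∧ P.cost = 0 := by
  obtain ⟨c⟩ := ‹Nonempty Z›
  let P : Protocol X Y Z k first :=
    ⟨fun _ _ => [], fun _ _ => [], fun _ _ => c, fun _ _ => c, fun _ => c⟩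
  have hP : P.PrefixFree := ⟨fun _ _ _ _ => rfl, fun _ _ _ _ => rfl⟩
  exact ⟨P.truncate 0, hP.truncate 0, Nat.le_zero.1 (P.cost_truncate_le 0)⟩

theorem PrivateCoinProtocol.exists_cost_le {R S : Type*} [Fintype R] [Fintype S]
    (P : PrivateCoinProtocol X Y Z R S k first) (A : Set Answerer) (f : X → Y → Z)
    (μ : PMF (X × Y)) {b η : ℝ} (hb : 0 < b) (h : 2 * P.infoCost μ + 10 * k ≤ η * b) :
    ∃ P' : Protocol X Y Z k first, P'.PrefixFree ∧ (P'.cost : ℝ) ≤ b ∧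
      P'.distError A f μ ≤ P.avgError A f μ + η := by
  have hlam : 0 ≤ b⁻¹ := inv_nonneg.2 hb.le
  obtain ⟨P', hP', hle⟩ := P.exists_sum_mul_loss_le A f μ hlam
  have hmarkov : ∀ z : X × Y,
      (P'.truncate ⌊b⌋₊).failure A f z.1 z.2 ≤ P'.loss A f b⁻¹ z.1 z.2 := fun z =>
    P'.failure_truncate_le A f hlam fun hbits => by
      rw [inv_mul_eq_div, one_le_div₀ hb]
      exact (Nat.lt_of_floor_lt hbits).le
  refine ⟨P'.truncate ⌊b⌋₊, hP'.truncate _,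
    (Nat.cast_le.2 (P'.cost_truncate_le _)).trans (Nat.floor_le hb.le), ?_⟩
  calc (P'.truncate ⌊b⌋₊).distError A f μ
      = ∑ z, (μ z).toReal * (P'.truncate ⌊b⌋₊).failure A f z.1 z.2 := Protocol.distError_eq_sum ..
    _ ≤ ∑ z, (μ z).toReal * P'.loss A f b⁻¹ z.1 z.2 :=
        Finset.sum_le_sum fun z _ => mul_le_mul_of_nonneg_left (hmarkov z) ENNReal.toReal_nonneg
    _ ≤ P.avgError A f μ + b⁻¹ * (2 * P.infoCost μ + 10 * k) := hle
    _ ≤ P.avgError A f μ + η := by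
        gcongr
        rwa [inv_mul_eq_div, div_le_iff₀ hb]

end BoundedCost

theorem codeCost_le_budget {k : ℕ} (hk : k ≠ 0) {a ε : ℝ} (ha : 0 ≤ a) (hε : 0 < ε)
    (hε' : ε ≤ 1 / 2) :
    2 * a + 10 * k ≤ 2 * ε * (2 * k * (a + 1) / ε ^ 2 + 2 * k / ε) := by
  have hk1 : (1 : ℝ) ≤ k := by exact_mod_cast Nat.one_le_iff_ne_zero.2 hk
  have hbudget : 2 * ε * (2 * k * (a + 1) / ε ^ 2 + 2 * k / ε)
      = 4 * (k * (a + 1)) / ε + 4 * k := by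
    field_simp
    ring
  have hdiv : 8 * (k * (a + 1)) ≤ 4 * (k * (a + 1)) / ε := by
    rw [le_div_iff₀ hε]
    nlinarith [show 0 ≤ k * (a + 1) by positivity]
  have hmul : a ≤ k * a := le_mul_of_one_le_left ha hk1
  rw [hbudget]
  linarith

end TwoParty

theorem mainTheorem1 {X Y Z R S : Type*} [Fintype X] [Fintype Y] [Fintype R] [Fintype S]
    (k : ℕ) (first : TwoParty.Party) (A : Set TwoParty.Answerer)
    (f : X → Y → Z) (μ : PMF (X × Y))
    (P : TwoParty.PrivateCoinProtocol X Y Z R S k first)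
    (δ a ε : ℝ) (hδ : P.avgError A f μ ≤ δ) (ha : P.infoCost μ ≤ a) (hε : 0 < ε) :
    ∃ P' : TwoParty.Protocol X Y Z k first,
      P'.PrefixFree ∧
      (P'.cost : ℝ) ≤ 2 * k * (a + 1) / ε ^ 2 + 2 * k / ε ∧
      P'.distError A f μ ≤ δ + 2 * ε := by
  have ha0 : 0 ≤ a := (TwoParty.mutualInfo_nonneg _ _ _).trans ha
  rcases eq_or_ne k 0 with rfl | hk
  · obtain ⟨P', hfree, -, herror⟩ := P.exists_cost_le A f μ (b := (a + 1) / ε) (η := 2 * ε)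
      (by positivity) (by field_simp; push_cast; linarith)
    exact ⟨P', hfree, by simp [P'.cost_eq_zero], by linarith⟩
  rcases le_or_gt ε (1 / 2) with hε' | hε'
  · obtain ⟨P', hfree, hcost, herror⟩ := P.exists_cost_le A f μ
      (b := 2 * k * (a + 1) / ε ^ 2 + 2 * k / ε) (η := 2 * ε) (by positivity)
      (le_trans (by gcongr) (TwoParty.codeCost_le_budget hk ha0 hε hε'))
    exact ⟨P', hfree, hcost, by linarith⟩
  · have : Nonempty Z := ⟨P.act.outTranscript []⟩
    obtain ⟨P', hfree, hcost⟩ :=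
      TwoParty.exists_prefixFree_cost_eq_zero (X := X) (Y := Y) (Z := Z) (k := k) (first := first)
    have hδ0 : 0 ≤ δ := (TwoParty.prob_nonneg _ _).trans hδ
    have herror : P'.distError A f μ ≤ 1 := TwoParty.prob_le_one _ _
    exact ⟨P', hfree, by rw [hcost, Nat.cast_zero]; positivity, by linarith⟩
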